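/- Let $\mathbb F=\mathbb F_q$ be a finite field with $q$ elements, let $V=\mathbb F^2\otimes\mathbb F^3$, and identify a tensor $\sum_{i,j} m_{ij}\,e_i\otimes e_j$ with the $2\times 3$ matrix $(m_{ij})$. Let $S_{2,3}\subset \mathrm{PG}(V)=\mathrm{PG}(5,q)$ be the Segre variety, i.e. the set of points $\langle a\otimes b\rangle$ with $a,b\neq 0$ (the points of rank one). For subspaces $A\le\mathbb F^2$, $B\le \mathbb F^3$ let $\sigma(A\times B)=\{\langle a\otimes b\rangle : 0\ne a\in A,\ 0\neq b\in B\}$; if $\dim A=a$ and $\dim B=b$ this is called an $S_{a,b}$ contained in $S_{2,3}$, and its span is $\mathrm{PG}(A\otimes B)$. Thus $S_{2,1}$'s are lines $\mathrm{PG}(\mathbb F^2\otimes v)$, $S_{1,2}$'s are lines $\mathrm{PG}(u\otimes W)$ with $\dim W=2$, and $S_{1,3}$'s are planes $\mathrm{PG}(u\otimes \mathbb F^3)$. Let $\bar H_2$ be the group of projectivities of $\mathrm{PG}(V)$ induced by the maps $g\otimes h$, $g\in \mathrm{GL}(\mathbb F^2)$, $h\in\mathrm{GL}(\mathbb F^3)$.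 Let $\beta_1,\beta_2$ be any nondegenerate symmetric bilinear forms on $\mathbb F^2$, $\mathbb F^3$, and let $U\mapsto U^\perp$ be taken with respect to the form on $V$ with $\beta(a\otimes b,c\otimes d)=\beta_1(a,c)\beta_2(b,d)$. A normal rational curve of degree $d$ is a set of points $\{\langle \sum_{i=0}^d s^{d-i}t^i c_i\rangle : (s,t)\in\mathbb F^2\setminus\{0\}\}$ with $c_0,\dots,c_d\in V$ linearly independent; for $d=2$ it is a conic. A cubic scroll is a set of points $\{\langle \lambda(sc_0+tc_1)+\mu(s^2c_2+stc_3+t^2c_4)\rangle: (s,t),(\lambda,\mu)\in\mathbb F^2\setminus\{0\}\}$ with $c_0,\dots,c_4\in V$ linearly independent. Consider the orbits of points $o_1,o_4$ and of lines $o_2,o_4^T,o_5,o_6,o_7,o_{10},o_{11}$ of $\mathrm{PG}(V)$ under $\bar H_2$ with the following representatives (points of the given matrix, respectively of all matrices of the given form, $x,y\in\mathbb F$): $$o_1:\begin{bmatrix}1&0&0\\0&0&0\end{bmatrix},\quad o_4:\begin{bmatrix}1&0&0\\0&1&0\end{bmatrix},\quad o_2:\begin{bmatrix}x&y&0\\0&0&0\end{bmatrix},\quad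 o_4^T:\begin{bmatrix}x&0&0\\y&0&0\end{bmatrix},\quad o_5:\begin{bmatrix}x&0&0\\0&y&0\end{bmatrix},$$ $$o_6:\begin{bmatrix}x&0&0\\y&x&0\end{bmatrix},\quad o_7:\begin{bmatrix}x&y&0\\0&0&x\end{bmatrix},\quad o_{10}:\begin{bmatrix}x&ux+y&0\\vy&x&0\end{bmatrix},\quad o_{11}:\begin{bmatrix}x&y&0\\0&x&y\end{bmatrix},$$ where for $o_{10}$ the elements $u,v\in\mathbb F$ satisfy $v\neq0$ and $v\lambda^2+uv\lambda-1\neq 0$ for all $\lambda\in\mathbb F$; such $u,v$ exist, and the statements below hold for every choice of them. For each of these orbits $o$, the subspaces $L^\perp$ with $L\in o$ all lie in one $\bar H_2$-orbit, denoted $o^\perp$. Then $\bar H_2$ has exactly $7$ orbits on the solids ($3$-dimensional projective subspaces) of $\mathrm{PG}(V)$, namely $o_2^\perp,(o_4^T)^\perp,o_5^\perp,o_6^\perp,o_7^\perp,o_{10}^\perp,o_{11}^\perp$, and exactly $2$ orbits on the hyperplanes of $\mathrm{PG}(V)$, namely $o_1^\perp,o_4^\perp$. For each of these orbits the following table gives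 a representative (the subspace of all matrices of the given form), and, for every member $\mathrm{PG}(U)$ of the orbit, the set $\mathrm{PG}(U)\cap S_{2,3}$, the dimensions $a\times b$ of the smallest $S_{a,b}$ contained in $S_{2,3}$ whose span contains $\mathrm{PG}(U)$ (Min), and the number of points of rank one in $\mathrm{PG}(U)$. $$\begin{array}{l|l|c|c|c} \text{Orbit}&\text{Intersection with }S_{2,3}&\text{Min}&\text{Representative}&\#\text{ rank }1\\\hline o_2^\perp&\text{the union of an }S_{1,3}\text{ (plane) and an }S_{2,1}\text{ (line)}&2\times3&\begin{bmatrix}0&0&x\\y&z&w\end{bmatrix}&q^2+2q+1\\ (o_4^T)^\perp&\text{an }S_{2,2}&2\times2&\begin{bmatrix}0&x&y\\0&z&w\end{bmatrix}&q^2+2q+1\\ o_5^\perp&\text{three lines: two disjoint }S_{1,2}\text{'s, both meeting an }S_{2,1}&2\times3&\begin{bmatrix}0&x&y\\z&0&w\end{bmatrix}&3q+1\\ o_6^\perp&\text{two intersecting lines, an }S_{2,1}\text{ and an }S_{1,2}&2\times3&\begin{bmatrix}x&y&z\\0&-x&w\end{bmatrix}&2q+1\\ o_7^\perp&\text{the union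 of a conic and an }S_{1,2}\text{ (line)}&2\times3&\begin{bmatrix}x&0&y\\z&w&-x\end{bmatrix}&2q+1\\ o_{10}^\perp&\text{a line }S_{2,1}&2\times3&\begin{bmatrix}x&-vy&z\\y&-x+uvy&w\end{bmatrix}&q+1\\ o_{11}^\perp&\text{a normal rational curve, of degree }3\text{ if }q\ge3\text{ and }2\text{ if }q=2&2\times3&\begin{bmatrix}x&y&z\\w&-x&-y\end{bmatrix}&q+1\\\hline o_1^\perp&\text{the union of an }S_{1,3}\text{ (plane) and an }S_{2,2}\text{, meeting in an }S_{1,2}\text{ (line)}&2\times3&\begin{bmatrix}0&x&y\\z&w&t\end{bmatrix}&2q^2+2q+1\\ o_4^\perp&\text{a cubic scroll}&2\times3&\begin{bmatrix}x&y&z\\w&-x&t\end{bmatrix}&(q+1)^2 \end{array}$$ -/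

import Mathlib

open scoped TensorProduct LinearAlgebra.Projectivization Pointwise

namespace Tensor23

/-- The tensor product space `F² ⊗ F³`. -/
abbrev V (F : Type*) [Field F] : Type _ := (Fin 2 → F) ⊗[F] (Fin 3 → F)

/-- The group `H₂` of all `g ⊗ h` with `g ∈ GL(F²)` and `h ∈ GL(F³)`, inside `GL(F² ⊗ F³)`. -/
def H₂ (F : Type*) [Field F] : Subgroup (V F ≃ₗ[F] V F) where
  carrier := {f | ∃ (g : (Fin 2 → F) ≃ₗ[F] (Fin 2 → F)) (h : (Fin 3 → F) ≃ₗ[F] (Fin 3 → F)),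
    f = TensorProduct.congr g h}
  mul_mem' := by
    rintro _ _ ⟨g, h, rfl⟩ ⟨g', h', rfl⟩
    exact ⟨g * g', h * h', (TensorProduct.congr_mul g h g' h').symm⟩
  one_mem' := ⟨1, 1, TensorProduct.congr_refl_refl.symm⟩
  inv_mem' := by
    rintro _ ⟨g, h, rfl⟩
    exact ⟨g⁻¹, h⁻¹, (TensorProduct.congr_symm g h).symm⟩

section

variable {F : Type*} [Field F]

/-- The orbit of the projective subspace `PG(U)` of `PG(F² ⊗ F³)` under the projective group
induced by `H₂`. Projective subspaces are represented by the corresponding linear subspaces, and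
the elements of `H₂` map a subspace to its image. -/
def orb (U : Submodule F (V F)) : Set (Submodule F (V F)) := MulAction.orbit (H₂ F) U

variable (F) in
/-- The set of orbits on `k`-dimensional linear subspaces, i.e. on projective subspaces of
projective dimension `k - 1` (solids for `k = 4`, hyperplanes for `k = 5`). -/
def orbitsOfDim (k : ℕ) : Set (Set (Submodule F (V F))) :=
  {O | ∃ U : Submodule F (V F), Module.finrank F U = k ∧ O = orb U}

/-- The orthogonal space of `U` for the form `β(a ⊗ b, c ⊗ d) = β₁(a, c) β₂(b, d)`. -/
noncomputable def perp (β₁ : LinearMap.BilinForm F (Fin 2 → F))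
    (β₂ : LinearMap.BilinForm F (Fin 3 → F)) (U : Submodule F (V F)) : Submodule F (V F) :=
  LinearMap.BilinForm.orthogonal (LinearMap.BilinForm.tmul β₁ β₂) U

/-! ### The Segre variety and its subvarieties -/

/-- The image `σ(PG(A) × PG(B))` of the Segre embedding restricted to `PG(A) × PG(B)`. -/
def segreSet (A : Submodule F (Fin 2 → F)) (B : Submodule F (Fin 3 → F)) : Set (ℙ F (V F)) :=
  {P | ∃ a ∈ A, ∃ b ∈ B, ∃ h : a ⊗ₜ[F] b ≠ 0, P = Projectivization.mk F (a ⊗ₜ[F] b) h}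

variable (F) in
/-- The Segre variety `S_{2,3}`: the points of rank one of `PG(F² ⊗ F³)`. -/
def segre : Set (ℙ F (V F)) := segreSet ⊤ ⊤

/-- The set of points of the projective subspace `PG(U)`. -/
def points (U : Submodule F (V F)) : Set (ℙ F (V F)) := {P | P.submodule ≤ U}

/-- The intersection of `PG(U)` with `S_{2,3}`. -/
def section23 (U : Submodule F (V F)) : Set (ℙ F (V F)) := points U ∩ segre F

/-- `S = σ(PG(A) × PG(B))` with `dim A = a` and `dim B = b`, i.e. `S` is an `S_{a,b}` contained in
`S_{2,3}`. So `S` is a line `PG(F² ⊗ v)` if `(a, b) = (2, 1)`, a line `PG(u ⊗ W)` with `dim W = 2`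
if `(a, b) = (1, 2)`, and a plane `PG(u ⊗ F³)` if `(a, b) = (1, 3)`. -/
def IsSubSegre (a b : ℕ) (S : Set (ℙ F (V F))) : Prop :=
  ∃ (A : Submodule F (Fin 2 → F)) (B : Submodule F (Fin 3 → F)),
    Module.finrank F A = a ∧ Module.finrank F B = b ∧ S = segreSet A B

/-- The subspace `A ⊗ B` of `F² ⊗ F³`, spanned by `σ(PG(A) × PG(B))`. -/
noncomputable def tensorSub (A : Submodule F (Fin 2 → F)) (B : Submodule F (Fin 3 → F)) :
    Submodule F (V F) :=
  Submodule.map₂ (TensorProduct.mk F (Fin 2 → F) (Fin 3 → F)) A B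

/-- The smallest Segre variety `σ(PG(A) × PG(B))` contained in `S_{2,3}` whose span contains
`PG(U)` is an `S_{a,b}`. -/
def HasMinSegre (U : Submodule F (V F)) (a b : ℕ) : Prop :=
  ∃ (A : Submodule F (Fin 2 → F)) (B : Submodule F (Fin 3 → F)),
    Module.finrank F A = a ∧ Module.finrank F B = b ∧ U ≤ tensorSub A B ∧
    ∀ (A' : Submodule F (Fin 2 → F)) (B' : Submodule F (Fin 3 → F)),
      U ≤ tensorSub A' B' → A ≤ A' ∧ B ≤ B'

/-! ### Rational curves and scrolls -/

/-- `S` is a normal rational curve of degree `d`: up to the choice of independent vectors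
`c 0, …, c d`, it is the set of points `(s^d, s^(d-1) t, …, t^d)` with `(s, t) ≠ (0, 0)`. A normal
rational curve of degree two is a conic. -/
def IsNormalRationalCurve (d : ℕ) (S : Set (ℙ F (V F))) : Prop :=
  ∃ c : Fin (d + 1) → V F, LinearIndependent F c ∧
    S = {P | ∃ (s t : F) (h : ∑ i : Fin (d + 1), (s ^ (d - (i : ℕ)) * t ^ (i : ℕ)) • c i ≠ 0),
      P = Projectivization.mk F _ h}

/-- `S` is a cubic scroll: the union of the lines that join corresponding points of a line
`{(s, t)}` and a conic `{(s², st, t²)}` in a plane, the line and the plane being disjoint and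
spanning a projective `4`-space. -/
def IsCubicScroll (S : Set (ℙ F (V F))) : Prop :=
  ∃ c : Fin 5 → V F, LinearIndependent F c ∧
    S = {P | ∃ (s t l m : F)
      (h : l • (s • c 0 + t • c 1) + m • (s ^ 2 • c 2 + (s * t) • c 3 + t ^ 2 • c 4) ≠ 0),
      P = Projectivization.mk F _ h}

/-! ### Representatives -/

/-- The tensor `∑ Mᵢⱼ eᵢ ⊗ eⱼ` with coordinate matrix `M`. -/
noncomputable def ofMat (M : Matrix (Fin 2) (Fin 3) F) : V F :=
  ∑ i, ∑ j, M i j • ((Pi.single i 1 : Fin 2 → F) ⊗ₜ[F] (Pi.single j 1 : Fin 3 → F))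

variable (F)

/-- Points: `o₁` is the orbit of a point of rank one, `o₄` that of a point of rank two. -/
noncomputable def pt1 : Submodule F (V F) := Submodule.span F {ofMat !![1, 0, 0; 0, 0, 0]}

noncomputable def pt4 : Submodule F (V F) := Submodule.span F {ofMat !![1, 0, 0; 0, 1, 0]}

/-- Representatives of the seven orbits of lines. -/
noncomputable def line2 : Submodule F (V F) :=
  Submodule.span F {T | ∃ x y : F, T = ofMat !![x, y, 0; 0, 0, 0]}

noncomputable def line4T : Submodule F (V F) :=
  Submodule.span F {T | ∃ x y : F, T = ofMat !![x, 0, 0; y, 0, 0]}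

noncomputable def line5 : Submodule F (V F) :=
  Submodule.span F {T | ∃ x y : F, T = ofMat !![x, 0, 0; 0, y, 0]}

noncomputable def line6 : Submodule F (V F) :=
  Submodule.span F {T | ∃ x y : F, T = ofMat !![x, 0, 0; y, x, 0]}

noncomputable def line7 : Submodule F (V F) :=
  Submodule.span F {T | ∃ x y : F, T = ofMat !![x, y, 0; 0, 0, x]}

noncomputable def line11 : Submodule F (V F) :=
  Submodule.span F {T | ∃ x y : F, T = ofMat !![x, y, 0; 0, x, y]}

/-- Representatives of the orbits of solids. -/
noncomputable def solid2 : Submodule F (V F) :=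
  Submodule.span F {T | ∃ x y z w : F, T = ofMat !![0, 0, x; y, z, w]}

noncomputable def solid4T : Submodule F (V F) :=
  Submodule.span F {T | ∃ x y z w : F, T = ofMat !![0, x, y; 0, z, w]}

noncomputable def solid5 : Submodule F (V F) :=
  Submodule.span F {T | ∃ x y z w : F, T = ofMat !![0, x, y; z, 0, w]}

noncomputable def solid6 : Submodule F (V F) :=
  Submodule.span F {T | ∃ x y z w : F, T = ofMat !![x, y, z; 0, -x, w]}

noncomputable def solid7 : Submodule F (V F) :=
  Submodule.span F {T | ∃ x y z w : F, T = ofMat !![x, 0, y; z, w, -x]}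

noncomputable def solid11 : Submodule F (V F) :=
  Submodule.span F {T | ∃ x y z w : F, T = ofMat !![x, y, z; w, -x, -y]}

/-- Representatives of the orbits of hyperplanes. -/
noncomputable def hyp1 : Submodule F (V F) :=
  Submodule.span F {T | ∃ x y z w t : F, T = ofMat !![0, x, y; z, w, t]}

noncomputable def hyp4 : Submodule F (V F) :=
  Submodule.span F {T | ∃ x y z w t : F, T = ofMat !![x, y, z; w, -x, t]}

variable {F}

/-- The condition on the parameters of `o₁₀`. -/
def Admissible (u v : F) : Prop := v ≠ 0 ∧ ∀ l : F, v * l ^ 2 + u * v * l - 1 ≠ 0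

noncomputable def line10 (u v : F) : Submodule F (V F) :=
  Submodule.span F {T | ∃ x y : F, T = ofMat !![x, u * x + y, 0; v * y, x, 0]}

noncomputable def solid10 (u v : F) : Submodule F (V F) :=
  Submodule.span F
    {T | ∃ x y z w : F, T = ofMat !![x, -(v * y), z; y, -x + u * v * y, w]}

/-- One row of the classification. For the orbit `o` of `L`, the perps of all members of `o` lie in
one orbit, namely `o^⊥ = orb (perp L)`; this orbit contains the representative `R`; and every
`U` in it has a section with `S_{2,3}` as described by `P`, has a minimal Segre variety
`S_{a,b}`, and contains exactly `N` points of rank one. -/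
def PerpRow (β₁ : LinearMap.BilinForm F (Fin 2 → F)) (β₂ : LinearMap.BilinForm F (Fin 3 → F))
    (L R : Submodule F (V F)) (P : Set (ℙ F (V F)) → Prop) (a b N : ℕ) : Prop :=
  (∀ L' ∈ orb L, perp β₁ β₂ L' ∈ orb (perp β₁ β₂ L)) ∧
  R ∈ orb (perp β₁ β₂ L) ∧
  ∀ U ∈ orb (perp β₁ β₂ L),
    P (section23 U) ∧ HasMinSegre U a b ∧ (section23 U).ncard = N

/-- A plane `PG(u ⊗ F³)` together with a line `PG(F² ⊗ v)`. -/
def IsPlaneAndLine (S : Set (ℙ F (V F))) : Prop :=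
  ∃ S₁ S₂, IsSubSegre 1 3 S₁ ∧ IsSubSegre 2 1 S₂ ∧ S = S₁ ∪ S₂

/-- Three lines: two disjoint lines `PG(u ⊗ W)`, both meeting a line `PG(F² ⊗ v)`. -/
def IsThreeLines (S : Set (ℙ F (V F))) : Prop :=
  ∃ S₀ S₁ S₂, IsSubSegre 2 1 S₀ ∧ IsSubSegre 1 2 S₁ ∧ IsSubSegre 1 2 S₂ ∧
    Disjoint S₁ S₂ ∧ (S₀ ∩ S₁).Nonempty ∧ (S₀ ∩ S₂).Nonempty ∧ S = S₀ ∪ S₁ ∪ S₂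

/-- Two intersecting lines, one `PG(F² ⊗ v)` and one `PG(u ⊗ W)`. -/
def IsTwoLines (S : Set (ℙ F (V F))) : Prop :=
  ∃ S₁ S₂, IsSubSegre 2 1 S₁ ∧ IsSubSegre 1 2 S₂ ∧ (S₁ ∩ S₂).Nonempty ∧ S = S₁ ∪ S₂

/-- A conic together with a line `PG(u ⊗ W)`. -/
def IsConicAndLine (S : Set (ℙ F (V F))) : Prop :=
  ∃ S₁ S₂, IsNormalRationalCurve 2 S₁ ∧ IsSubSegre 1 2 S₂ ∧ S = S₁ ∪ S₂

/-- A plane `PG(u ⊗ F³)` together with an `S_{2,2}`, meeting in a line `PG(u ⊗ W)`. -/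
def IsPlaneAndS22 (S : Set (ℙ F (V F))) : Prop :=
  ∃ S₁ S₂, IsSubSegre 1 3 S₁ ∧ IsSubSegre 2 2 S₂ ∧ IsSubSegre 1 2 (S₁ ∩ S₂) ∧ S = S₁ ∪ S₂

end

end Tensor23

/-! The theorem is the dual of a classification of points and lines. Each `g ⊗ h` has an adjoint of
the same shape, even between two different pairs of nondegenerate symmetric forms (`perp_mem_orb`).
Hence `⊥` carries orbits to orbits, and the orbit of `L^⊥` does not depend on the forms. One may
therefore work with the dot products, for which the orthogonal space of a matrix representative is
given by linear equations in the matrix entries. Since `U^⊥⊥ = U`, solids correspond to lines and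
hyperplanes to points.

A point is spanned by a tensor of rank one or two. For a line through a point `a ⊗ p`, write a
second generator as `a ⊗ r + a' ⊗ s`. The linear relations among `p`, `r`, `s` decide between `o₂`,
`o₄ᵀ`, `o₅`, `o₆`, `o₇` (`isClassified_of_tmul_mem`). Suppose now that the line has no point of rank
one. If both generators have their rows in one common plane of `F³`, the second is `X` times the
first for a `2 × 2` matrix `X` without eigenvalues in `F`. A finite field has only one quadratic
extension, so some `α + βX` with `β ≠ 0` has any prescribed trace and determinant of an irreducible
quadratic (`exists_trace_norm_eq`), and the line is in `o₁₀` (`mem_orb_line10`). Otherwise a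
functional on `F³` kills the rows of one generator but not those of the other, and adapted bases
give `o₁₁` (`mem_orb_line11`).

Sections, minimal Segre varieties and numbers of rank-one points are all transported by `g ⊗ h`, so
each is computed on one representative (`perpRow_of_rep`). Rank-one points are counted by fixing the
first factor `a`: the admissible second factors form a subspace of `F³`. These counts separate the
nine orbits except for three pairs of solids. The pair `o₂^⊥`, `(o₄ᵀ)^⊥` is separated by the minimal
Segre variety. The pairs `o₆^⊥`, `o₇^⊥` and `o₁₀^⊥`, `o₁₁^⊥` are separated by whether the solid
contains a line `PG(F² ⊗ v)`. -/

namespace Tensor23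

section

variable {F : Type*} [Field F]

/-! ### Coordinates -/

/-- The standard vector `eᵢ` of `F^n`. -/
abbrev stdVec (F : Type*) [Field F] {n : ℕ} (i : Fin n) : Fin n → F := Pi.single i 1

/-- The standard tensor `eᵢ ⊗ eⱼ`. -/
noncomputable def E (F : Type*) [Field F] (i : Fin 2) (j : Fin 3) : V F :=
  stdVec F i ⊗ₜ[F] stdVec F j

/-- The coordinates of a tensor with respect to the standard tensors. -/
noncomputable def coord (i : Fin 2) (j : Fin 3) : V F →ₗ[F] F :=
  TensorProduct.lift ((LinearMap.mul F F).compl₁₂ (LinearMap.proj i) (LinearMap.proj j))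

@[simp] lemma coord_tmul (i : Fin 2) (j : Fin 3) (a : Fin 2 → F) (b : Fin 3 → F) :
    coord i j (a ⊗ₜ[F] b) = a i * b j := rfl

lemma ofMat_eq (M : Matrix (Fin 2) (Fin 3) F) : ofMat M = ∑ i, ∑ j, M i j • E F i j := rfl

@[simp] lemma coord_E (i k : Fin 2) (j l : Fin 3) :
    coord i j (E F k l) = if i = k ∧ j = l then 1 else 0 := by
  simp only [E, coord_tmul, Pi.single_apply, ite_and, mul_ite, mul_one, mul_zero]
  split_ifs <;> rfl

@[simp] lemma coord_ofMat (M : Matrix (Fin 2) (Fin 3) F) (i : Fin 2) (j : Fin 3) :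
    coord i j (ofMat M) = M i j := by
  simp only [ofMat_eq, map_sum, map_smul, coord_E, smul_eq_mul]
  fin_cases i <;> fin_cases j <;> simp [Fin.sum_univ_succ]

lemma ofMat_coord (x : V F) : ofMat (Matrix.of fun i j => coord i j x) = x := by
  induction x using TensorProduct.induction_on with
  | zero => simp [ofMat_eq]
  | add x y hx hy =>
    conv_rhs => rw [← hx, ← hy]
    simp only [ofMat_eq, map_add, Matrix.of_apply, add_smul, Finset.sum_add_distrib]
  | tmul a b =>
    simp only [ofMat_eq, Matrix.of_apply, coord_tmul, E]
    conv_rhs => rw [pi_eq_sum_univ' a, pi_eq_sum_univ' b]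
    simp only [TensorProduct.sum_tmul, TensorProduct.tmul_sum, ← TensorProduct.smul_tmul',
      TensorProduct.tmul_smul, Finset.smul_sum, smul_smul]
    rw [Finset.sum_comm]
    simp only [mul_comm]

lemma ext_coord {x y : V F} (h : ∀ i j, coord i j x = coord i j y) : x = y := by
  rw [← ofMat_coord x, ← ofMat_coord y]
  simp only [h]

lemma eq_add_tmul (x : V F) : ∃ r s : Fin 3 → F, x = stdVec F 0 ⊗ₜ[F] r + stdVec F 1 ⊗ₜ[F] s := by
  refine ⟨fun j => coord 0 j x, fun j => coord 1 j x, ext_coord fun i j => ?_⟩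
  fin_cases i <;> simp

/-- The contraction of a tensor with the `i`-th coordinate of the first factor. -/
noncomputable def row (i : Fin 2) : V F →ₗ[F] (Fin 3 → F) := LinearMap.pi fun j => coord i j

/-- The contraction of a tensor with the `j`-th coordinate of the second factor. -/
noncomputable def col (j : Fin 3) : V F →ₗ[F] (Fin 2 → F) := LinearMap.pi fun i => coord i j

lemma row_tmul (i : Fin 2) (a : Fin 2 → F) (b : Fin 3 → F) : row i (a ⊗ₜ[F] b) = a i • b := rfl

lemma col_tmul (j : Fin 3) (a : Fin 2 → F) (b : Fin 3 → F) : col j (a ⊗ₜ[F] b) = b j • a := by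
  ext i; exact mul_comm _ _

lemma tmul_ne_zero {a : Fin 2 → F} {b : Fin 3 → F} (ha : a ≠ 0) (hb : b ≠ 0) :
    a ⊗ₜ[F] b ≠ 0 := by
  obtain ⟨i, hi⟩ := Function.ne_iff.1 ha
  obtain ⟨j, hj⟩ := Function.ne_iff.1 hb
  intro h
  have := congrArg (coord i j) h
  simp only [coord_tmul, map_zero, mul_eq_zero] at this
  exact this.elim hi hj

lemma left_ne_zero {a : Fin 2 → F} {b : Fin 3 → F} (h : a ⊗ₜ[F] b ≠ 0) : a ≠ 0 := by
  rintro rfl; simp at h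

lemma right_ne_zero {a : Fin 2 → F} {b : Fin 3 → F} (h : a ⊗ₜ[F] b ≠ 0) : b ≠ 0 := by
  rintro rfl; simp at h

lemma row_mem {A : Submodule F (Fin 2 → F)} {B : Submodule F (Fin 3 → F)} {x : V F}
    (hx : x ∈ tensorSub A B) (i : Fin 2) : row i x ∈ B := by
  have : tensorSub A B ≤ B.comap (row i) := by
    refine Submodule.map₂_le.2 fun a _ b hb => ?_
    simpa [row_tmul] using B.smul_mem _ hb
  exact this hx

lemma col_mem {A : Submodule F (Fin 2 → F)} {B : Submodule F (Fin 3 → F)} {x : V F}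
    (hx : x ∈ tensorSub A B) (j : Fin 3) : col j x ∈ A := by
  have : tensorSub A B ≤ A.comap (col j) := by
    refine Submodule.map₂_le.2 fun a ha b _ => ?_
    simpa [col_tmul] using A.smul_mem _ ha
  exact this hx

lemma tmul_mem_tensorSub {A : Submodule F (Fin 2 → F)} {B : Submodule F (Fin 3 → F)}
    {a : Fin 2 → F} {b : Fin 3 → F} (ha : a ∈ A) (hb : b ∈ B) : a ⊗ₜ[F] b ∈ tensorSub A B :=
  Submodule.apply_mem_map₂ _ ha hb

/-- Contracting with a coordinate where `a` is nonzero returns a nonzero multiple of `b`, and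
symmetrically. Thus a nonzero pure tensor determines its two factors up to scalars. -/
lemma mem_of_tmul_mem {A : Submodule F (Fin 2 → F)} {B : Submodule F (Fin 3 → F)}
    {a : Fin 2 → F} {b : Fin 3 → F} (h0 : a ⊗ₜ[F] b ≠ 0) (h : a ⊗ₜ[F] b ∈ tensorSub A B) :
    a ∈ A ∧ b ∈ B := by
  obtain ⟨i, hi⟩ := Function.ne_iff.1 (left_ne_zero h0)
  obtain ⟨j, hj⟩ := Function.ne_iff.1 (right_ne_zero h0)
  have h1 := row_mem h i
  have h2 := col_mem h j
  rw [row_tmul] at h1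
  rw [col_tmul] at h2
  exact ⟨(A.smul_mem_iff hj).1 h2, (B.smul_mem_iff hi).1 h1⟩

/-! ### Orbits -/

lemma smul_eq_map (g : (Fin 2 → F) ≃ₗ[F] (Fin 2 → F)) (h : (Fin 3 → F) ≃ₗ[F] (Fin 3 → F))
    (H : TensorProduct.congr g h ∈ H₂ F) (U : Submodule F (V F)) :
    (⟨TensorProduct.congr g h, H⟩ : H₂ F) • U =
      U.map (TensorProduct.congr g h : V F ≃ₗ[F] V F).toLinearMap := by
  ext x
  exact Iff.rfl

lemma mem_orb {U U' : Submodule F (V F)} : U' ∈ orb U ↔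
    ∃ (g : (Fin 2 → F) ≃ₗ[F] (Fin 2 → F)) (h : (Fin 3 → F) ≃ₗ[F] (Fin 3 → F)),
      U' = U.map (TensorProduct.congr g h : V F ≃ₗ[F] V F).toLinearMap := by
  constructor
  · rintro ⟨⟨f, g, h, rfl⟩, rfl⟩
    exact ⟨g, h, smul_eq_map _ _ _ _⟩
  · rintro ⟨g, h, rfl⟩
    exact ⟨⟨TensorProduct.congr g h, g, h, rfl⟩, smul_eq_map _ _ _ _⟩

lemma mem_orb_self (U : Submodule F (V F)) : U ∈ orb U := MulAction.mem_orbit_self U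

lemma orb_eq {U U' : Submodule F (V F)} (h : U' ∈ orb U) : orb U' = orb U :=
  MulAction.orbit_eq_iff.2 h

lemma mem_orb_symm {U U' : Submodule F (V F)} (h : U' ∈ orb U) : U ∈ orb U' :=
  MulAction.mem_orbit_symm.1 h

/-! ### Orthogonal spaces -/

/-- The adjoint of a linear equivalence with respect to two nondegenerate forms. -/
lemma exists_adjoint {n : ℕ} {β γ : LinearMap.BilinForm F (Fin n → F)}
    (hβ : β.Nondegenerate) (hβs : β.IsSymm) (hγ : γ.Nondegenerate) (hγs : γ.IsSymm)
    (g : (Fin n → F) ≃ₗ[F] (Fin n → F)) :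
    ∃ g' : (Fin n → F) ≃ₗ[F] (Fin n → F), ∀ x y, β (g x) y = γ x (g' y) := by
  refine ⟨(β.toDual hβ ≪≫ₗ g.dualMap) ≪≫ₗ (γ.toDual hγ).symm, fun x y => ?_⟩
  -- `toDual` feeds its vector into the first slot, so both sides are flipped by symmetry.
  rw [hγs.eq, hβs.eq]
  simp [LinearMap.BilinForm.toDual_def]

/-- A vector `y` is `β`-orthogonal to `(g ⊗ h)U` exactly when its image under the adjoint `g' ⊗ h'`
is `γ`-orthogonal to `U`. Allowing two pairs of forms serves two purposes: `⊥` respects orbits, and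
any pair of forms may be replaced by the dot products. -/
lemma perp_mem_orb {β₁ γ₁ : LinearMap.BilinForm F (Fin 2 → F)}
    {β₂ γ₂ : LinearMap.BilinForm F (Fin 3 → F)}
    (hβ₁ : β₁.Nondegenerate) (hβ₁s : β₁.IsSymm) (hγ₁ : γ₁.Nondegenerate) (hγ₁s : γ₁.IsSymm)
    (hβ₂ : β₂.Nondegenerate) (hβ₂s : β₂.IsSymm) (hγ₂ : γ₂.Nondegenerate) (hγ₂s : γ₂.IsSymm)
    {U U' : Submodule F (V F)} (hU : U' ∈ orb U) :
    perp β₁ β₂ U' ∈ orb (perp γ₁ γ₂ U) := by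
  obtain ⟨g, h, rfl⟩ := mem_orb.1 hU
  obtain ⟨g', hg'⟩ := exists_adjoint hβ₁ hβ₁s hγ₁ hγ₁s g
  obtain ⟨h', hh'⟩ := exists_adjoint hβ₂ hβ₂s hγ₂ hγ₂s h
  have key : ∀ x y : V F, LinearMap.BilinForm.tmul β₁ β₂ (TensorProduct.congr g h x) y =
      LinearMap.BilinForm.tmul γ₁ γ₂ x (TensorProduct.congr g' h' y) := by
    intro x y
    induction x using TensorProduct.induction_on with
    | zero => simp
    | add x x' hx hx' => simp only [map_add, LinearMap.add_apply, hx, hx']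
    | tmul a b =>
      induction y using TensorProduct.induction_on with
      | zero => simp
      | add y y' hy hy' => simp only [map_add, hy, hy']
      | tmul c d =>
        simp only [TensorProduct.congr_tmul, LinearMap.BilinForm.tensorDistrib_tmul, hg', hh']
  -- The adjoint goes backwards: it maps the `β`-perp of the image onto the `γ`-perp of `U`.
  refine mem_orb_symm (mem_orb.2 ⟨g', h', ?_⟩)
  ext y
  constructor
  · intro hy
    refine ⟨(TensorProduct.congr g' h').symm y, ?_, LinearEquiv.apply_symm_apply _ _⟩
    rintro _ ⟨x, hx, rfl⟩
    change LinearMap.BilinForm.tmul β₁ β₂ _ _ = 0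
    refine (key x _).trans ?_
    rw [LinearEquiv.apply_symm_apply]
    exact hy x hx
  · rintro ⟨y, hy, rfl⟩ x hx
    exact (key x y).symm.trans (hy _ ⟨x, hx, rfl⟩)

/-- The standard symmetric bilinear form. -/
noncomputable def stdForm (F : Type*) [Field F] (n : ℕ) : LinearMap.BilinForm F (Fin n → F) :=
  dotProductBilin F F

lemma stdForm_apply {n : ℕ} (x y : Fin n → F) : stdForm F n x y = x ⬝ᵥ y := rfl

lemma stdForm_isSymm (n : ℕ) : (stdForm F n).IsSymm := ⟨fun x y => dotProduct_comm x y⟩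

lemma stdForm_nondegenerate (n : ℕ) : (stdForm F n).Nondegenerate := by
  refine (LinearMap.IsRefl.nondegenerate_iff_separatingLeft
    (stdForm_isSymm (F := F) n).isRefl).2 fun x hx => ?_
  ext i
  simpa [stdForm_apply] using hx (Pi.single i 1)

/-- The standard bilinear form on `F² ⊗ F³`. -/
noncomputable def tensorForm (F : Type*) [Field F] : LinearMap.BilinForm F (V F) :=
  LinearMap.BilinForm.tmul (stdForm F 2) (stdForm F 3)

lemma tensorForm_isSymm : (tensorForm F).IsSymm :=
  LinearMap.BilinForm.isSymm_iff.2 <| LinearMap.IsSymm.tmul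
    (LinearMap.BilinForm.isSymm_iff.1 (stdForm_isSymm 2))
    (LinearMap.BilinForm.isSymm_iff.1 (stdForm_isSymm 3))

/-- Pairing with a standard tensor reads off one coordinate, so orthogonality to a matrix
representative becomes a linear equation in the entries. -/
lemma tensorForm_E (i : Fin 2) (j : Fin 3) (x : V F) : tensorForm F (E F i j) x = coord i j x := by
  have : tensorForm F (E F i j) = coord i j := by
    refine TensorProduct.ext' fun a b => ?_
    refine (LinearMap.BilinForm.tensorDistrib_tmul F F _ _ _ _ _ _).trans ?_
    simp [stdForm_apply, mul_comm]
  rw [this]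

lemma tensorForm_nondegenerate : (tensorForm F).Nondegenerate := by
  refine (LinearMap.IsRefl.nondegenerate_iff_separatingRight
    (tensorForm_isSymm (F := F)).isRefl).2 fun x hx => ?_
  exact ext_coord fun i j => by rw [← tensorForm_E, hx, map_zero]

/-- The orthogonal space for the standard form. -/
noncomputable abbrev stdPerp (U : Submodule F (V F)) : Submodule F (V F) :=
  perp (stdForm F 2) (stdForm F 3) U

lemma finrank_V : Module.finrank F (V F) = 6 := by
  rw [Module.finrank_tensorProduct]; simp

lemma finrank_stdPerp (U : Submodule F (V F)) :
    Module.finrank F (stdPerp U) = 6 - Module.finrank F U := by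
  rw [← finrank_V (F := F)]
  exact LinearMap.BilinForm.finrank_orthogonal tensorForm_nondegenerate U

lemma stdPerp_stdPerp (U : Submodule F (V F)) : stdPerp (stdPerp U) = U :=
  LinearMap.BilinForm.orthogonal_orthogonal tensorForm_nondegenerate tensorForm_isSymm.isRefl U

lemma mem_stdPerp_span {S : Set (V F)} {x : V F} :
    x ∈ stdPerp (Submodule.span F S) ↔ ∀ y ∈ S, tensorForm F y x = 0 := by
  constructor
  · exact fun h y hy => h y (Submodule.subset_span hy)
  · intro h y hy
    change tensorForm F y x = 0
    induction hy using Submodule.span_induction with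
    | mem y hy => exact h y hy
    | zero => simp
    | add y z _ _ hy hz => simp [hy, hz]
    | smul c y _ hy => simp [hy]

end

end Tensor23

namespace Tensor23

section

variable {F : Type*} [Field F]

/-! ### Transport of the geometry under `g ⊗ h` -/

/-- The projectivity of `PG(F² ⊗ F³)` induced by `g ⊗ h`. -/
noncomputable def pmap (g : (Fin 2 → F) ≃ₗ[F] (Fin 2 → F)) (h : (Fin 3 → F) ≃ₗ[F] (Fin 3 → F)) :
    ℙ F (V F) → ℙ F (V F) :=
  Projectivization.map (TensorProduct.congr g h : V F ≃ₗ[F] V F).toLinearMap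
    (LinearEquiv.injective _)

variable (g : (Fin 2 → F) ≃ₗ[F] (Fin 2 → F)) (h : (Fin 3 → F) ≃ₗ[F] (Fin 3 → F))

lemma pmap_injective : Function.Injective (pmap g h) := Projectivization.map_injective _ _

lemma congr_ne_zero {x : V F} (hx : x ≠ 0) : TensorProduct.congr g h x ≠ 0 :=
  (LinearEquiv.map_ne_zero_iff (TensorProduct.congr g h)).2 hx

lemma pmap_mk (x : V F) (hx : x ≠ 0) :
    pmap g h (Projectivization.mk F x hx) =
      Projectivization.mk F (TensorProduct.congr g h x) (congr_ne_zero g h hx) := rfl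

lemma pmap_mk_eq {x y : V F} (hx : x ≠ 0) (hy : y ≠ 0) (hxy : TensorProduct.congr g h x = y) :
    pmap g h (Projectivization.mk F x hx) = Projectivization.mk F y hy := by
  subst hxy; rfl

lemma mk_mem_points {U : Submodule F (V F)} {x : V F} (hx : x ≠ 0) :
    Projectivization.mk F x hx ∈ points U ↔ x ∈ U := by
  change (Projectivization.mk F x hx).submodule ≤ U ↔ _
  rw [Projectivization.submodule_mk, Submodule.span_singleton_le_iff_mem]

/-- A family of points of `PG(F² ⊗ F³)` given by a parametrization `φ` with values in `F² ⊗ F³`. -/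
def paramSet {X : Type*} (φ : X → V F) : Set (ℙ F (V F)) :=
  {P | ∃ x, ∃ hx : φ x ≠ 0, P = Projectivization.mk F (φ x) hx}

lemma image_paramSet {X : Type*} (φ : X → V F) :
    pmap g h '' paramSet φ = paramSet fun x => TensorProduct.congr g h (φ x) := by
  ext P
  constructor
  · rintro ⟨_, ⟨x, hx, rfl⟩, rfl⟩
    exact ⟨x, congr_ne_zero g h hx, rfl⟩
  · rintro ⟨x, hx, rfl⟩
    have hx' : φ x ≠ 0 := fun h0 => hx ((congrArg _ h0).trans (map_zero _))
    exact ⟨_, ⟨x, hx', rfl⟩, rfl⟩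

lemma image_segreSet (A : Submodule F (Fin 2 → F)) (B : Submodule F (Fin 3 → F)) :
    pmap g h '' segreSet A B = segreSet (A.map g.toLinearMap) (B.map h.toLinearMap) := by
  ext P
  constructor
  · rintro ⟨_, ⟨a, ha, b, hb, hab, rfl⟩, rfl⟩
    exact ⟨g a, ⟨a, ha, rfl⟩, h b, ⟨b, hb, rfl⟩, congr_ne_zero g h hab, rfl⟩
  · rintro ⟨_, ⟨a, ha, rfl⟩, _, ⟨b, hb, rfl⟩, hab, rfl⟩
    have hab' : a ⊗ₜ[F] b ≠ 0 := fun h0 => hab (by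
      simpa using congrArg (TensorProduct.congr g h) h0)
    exact ⟨_, ⟨a, ha, b, hb, hab', rfl⟩, rfl⟩

lemma image_points (U : Submodule F (V F)) :
    pmap g h '' points U =
      points (U.map (TensorProduct.congr g h : V F ≃ₗ[F] V F).toLinearMap) := by
  ext P
  constructor
  · rintro ⟨Q, hQ, rfl⟩
    induction Q using Projectivization.ind with
    | h x hx =>
      rw [mk_mem_points] at hQ
      rw [pmap_mk, mk_mem_points]
      exact ⟨x, hQ, rfl⟩
  · induction P using Projectivization.ind with
    | h x hx =>
      rw [mk_mem_points]
      rintro ⟨y, hy, hxy⟩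
      have hy0 : y ≠ 0 := by rintro rfl; exact hx (by rw [← hxy, map_zero])
      exact ⟨Projectivization.mk F y hy0, (mk_mem_points hy0).2 hy, pmap_mk_eq g h _ _ hxy⟩

lemma image_section23 (U : Submodule F (V F)) :
    pmap g h '' section23 U =
      section23 (U.map (TensorProduct.congr g h : V F ≃ₗ[F] V F).toLinearMap) := by
  rw [section23, Set.image_inter (pmap_injective g h), image_points, segre, image_segreSet,
    Submodule.map_top, Submodule.map_top, LinearEquiv.range, LinearEquiv.range]
  rfl

lemma ncard_section23_of_mem_orb {U U' : Submodule F (V F)} (hU : U' ∈ orb U) :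
    (section23 U').ncard = (section23 U).ncard := by
  obtain ⟨g, h, rfl⟩ := mem_orb.1 hU
  rw [← image_section23, Set.ncard_image_of_injective _ (pmap_injective g h)]

variable {g h}

lemma IsSubSegre.image {a b : ℕ} {S : Set (ℙ F (V F))} (hS : IsSubSegre a b S) :
    IsSubSegre a b (pmap g h '' S) := by
  obtain ⟨A, B, hA, hB, rfl⟩ := hS
  refine ⟨_, _, ?_, ?_, image_segreSet g h A B⟩
  · rw [← hA]; exact LinearEquiv.finrank_map_eq g A
  · rw [← hB]; exact LinearEquiv.finrank_map_eq h B

lemma linearIndependent_congr {ι : Type*} {c : ι → V F} (hc : LinearIndependent F c) :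
    LinearIndependent F fun i => TensorProduct.congr g h (c i) :=
  hc.map' (TensorProduct.congr g h : V F ≃ₗ[F] V F).toLinearMap (LinearEquiv.ker _)

lemma isNormalRationalCurve_iff {d : ℕ} {S : Set (ℙ F (V F))} :
    IsNormalRationalCurve d S ↔ ∃ c : Fin (d + 1) → V F, LinearIndependent F c ∧
      S = paramSet fun p : F × F => ∑ i : Fin (d + 1), (p.1 ^ (d - (i : ℕ)) * p.2 ^ (i : ℕ)) • c i := by
  simp [IsNormalRationalCurve, paramSet]

lemma isCubicScroll_iff {S : Set (ℙ F (V F))} :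
    IsCubicScroll S ↔ ∃ c : Fin 5 → V F, LinearIndependent F c ∧
      S = paramSet fun p : F × F × F × F => p.2.2.1 • (p.1 • c 0 + p.2.1 • c 1) +
        p.2.2.2 • (p.1 ^ 2 • c 2 + (p.1 * p.2.1) • c 3 + p.2.1 ^ 2 • c 4) := by
  simp [IsCubicScroll, paramSet]

lemma IsNormalRationalCurve.image {d : ℕ} {S : Set (ℙ F (V F))} (hS : IsNormalRationalCurve d S) :
    IsNormalRationalCurve d (pmap g h '' S) := by
  rw [isNormalRationalCurve_iff] at hS ⊢
  obtain ⟨c, hc, rfl⟩ := hS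
  refine ⟨_, linearIndependent_congr (g := g) (h := h) hc, ?_⟩
  rw [image_paramSet]
  simp only [map_sum, map_smul]

lemma IsCubicScroll.image {S : Set (ℙ F (V F))} (hS : IsCubicScroll S) :
    IsCubicScroll (pmap g h '' S) := by
  rw [isCubicScroll_iff] at hS ⊢
  obtain ⟨c, hc, rfl⟩ := hS
  refine ⟨_, linearIndependent_congr (g := g) (h := h) hc, ?_⟩
  rw [image_paramSet]
  simp only [map_add, map_smul]

lemma IsPlaneAndLine.image {S : Set (ℙ F (V F))} (hS : IsPlaneAndLine S) :
    IsPlaneAndLine (pmap g h '' S) := by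
  obtain ⟨S₁, S₂, h₁, h₂, rfl⟩ := hS
  exact ⟨_, _, h₁.image, h₂.image, Set.image_union _ _ _⟩

lemma inter_nonempty_image {S₁ S₂ : Set (ℙ F (V F))} (hS : (S₁ ∩ S₂).Nonempty) :
    (pmap g h '' S₁ ∩ pmap g h '' S₂).Nonempty := by
  rw [← Set.image_inter (pmap_injective g h)]
  exact hS.image _

lemma IsThreeLines.image {S : Set (ℙ F (V F))} (hS : IsThreeLines S) :
    IsThreeLines (pmap g h '' S) := by
  obtain ⟨S₀, S₁, S₂, h₀, h₁, h₂, hd, h01, h02, rfl⟩ := hS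
  refine ⟨_, _, _, h₀.image, h₁.image, h₂.image,
    (Set.disjoint_image_iff (pmap_injective g h)).2 hd, inter_nonempty_image h01,
    inter_nonempty_image h02, ?_⟩
  rw [Set.image_union, Set.image_union]

lemma IsTwoLines.image {S : Set (ℙ F (V F))} (hS : IsTwoLines S) :
    IsTwoLines (pmap g h '' S) := by
  obtain ⟨S₁, S₂, h₁, h₂, h12, rfl⟩ := hS
  exact ⟨_, _, h₁.image, h₂.image, inter_nonempty_image h12, Set.image_union _ _ _⟩

lemma IsConicAndLine.image {S : Set (ℙ F (V F))} (hS : IsConicAndLine S) :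
    IsConicAndLine (pmap g h '' S) := by
  obtain ⟨S₁, S₂, h₁, h₂, rfl⟩ := hS
  exact ⟨_, _, h₁.image, h₂.image, Set.image_union _ _ _⟩

lemma IsPlaneAndS22.image {S : Set (ℙ F (V F))} (hS : IsPlaneAndS22 S) :
    IsPlaneAndS22 (pmap g h '' S) := by
  obtain ⟨S₁, S₂, h₁, h₂, h12, rfl⟩ := hS
  refine ⟨_, _, h₁.image, h₂.image, ?_, Set.image_union _ _ _⟩
  rw [← Set.image_inter (pmap_injective g h)]
  exact h12.image

variable (g h) in
lemma map_tensorSub (A : Submodule F (Fin 2 → F)) (B : Submodule F (Fin 3 → F)) :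
    (tensorSub A B).map (TensorProduct.congr g h : V F ≃ₗ[F] V F).toLinearMap =
      tensorSub (A.map g.toLinearMap) (B.map h.toLinearMap) := by
  apply le_antisymm
  · rw [Submodule.map_le_iff_le_comap]
    refine Submodule.map₂_le.2 fun a ha b hb => ?_
    exact tmul_mem_tensorSub (Submodule.mem_map_of_mem ha) (Submodule.mem_map_of_mem hb)
  · refine Submodule.map₂_le.2 ?_
    rintro _ ⟨a, ha, rfl⟩ _ ⟨b, hb, rfl⟩
    exact ⟨a ⊗ₜ b, tmul_mem_tensorSub ha hb, rfl⟩

lemma HasMinSegre.of_mem_orb {U U' : Submodule F (V F)} {a b : ℕ} (hU : HasMinSegre U a b)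
    (hU' : U' ∈ orb U) : HasMinSegre U' a b := by
  obtain ⟨g, h, rfl⟩ := mem_orb.1 hU'
  obtain ⟨A, B, hA, hB, hAB, hmin⟩ := hU
  refine ⟨A.map g.toLinearMap, B.map h.toLinearMap, ?_, ?_, ?_, ?_⟩
  · rw [← hA]; exact LinearEquiv.finrank_map_eq g A
  · rw [← hB]; exact LinearEquiv.finrank_map_eq h B
  · rw [← map_tensorSub]; exact Submodule.map_mono hAB
  · intro A' B' hle
    rw [Submodule.map_le_iff_le_comap, Submodule.map_le_iff_le_comap]
    apply hmin
    have hA' : (A'.comap g.toLinearMap).map g.toLinearMap = A' :=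
      Submodule.map_comap_eq_of_surjective g.surjective A'
    -- Written as images of their preimages, `A'` and `B'` can be pulled back along `g ⊗ h`, where
    -- minimality for `U` applies.
    have hB' : (B'.comap h.toLinearMap).map h.toLinearMap = B' :=
      Submodule.map_comap_eq_of_surjective h.surjective B'
    rw [← hA', ← hB', ← map_tensorSub] at hle
    exact (Submodule.map_le_map_iff_of_injective (LinearEquiv.injective _) _ _).1 hle

/-- This turns the Min column into an orbit invariant. -/
lemma HasMinSegre.unique {U : Submodule F (V F)} {a b a' b' : ℕ} (hU : HasMinSegre U a b)
    (hU' : HasMinSegre U a' b') : a = a' ∧ b = b' := by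
  obtain ⟨A, B, rfl, rfl, hle, hmin⟩ := hU
  obtain ⟨A', B', rfl, rfl, hle', hmin'⟩ := hU'
  obtain ⟨h₁, h₂⟩ := hmin _ _ hle'
  obtain ⟨h₃, h₄⟩ := hmin' _ _ hle
  rw [le_antisymm h₁ h₃, le_antisymm h₂ h₄]
  exact ⟨rfl, rfl⟩

/-- `PG(U)` contains a line `PG(F² ⊗ v)`. -/
def ContainsLine21 (U : Submodule F (V F)) : Prop := ∃ v : Fin 3 → F, v ≠ 0 ∧ ∀ a, a ⊗ₜ[F] v ∈ U

/-- The invariant that separates the solids `o₆^⊥` from `o₇^⊥` and `o₁₀^⊥` from `o₁₁^⊥`, whose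
numbers of rank-one points agree. -/
lemma ContainsLine21.of_mem_orb {U U' : Submodule F (V F)} (hU : ContainsLine21 U)
    (hU' : U' ∈ orb U) : ContainsLine21 U' := by
  obtain ⟨g, h, rfl⟩ := mem_orb.1 hU'
  obtain ⟨v, hv, hU⟩ := hU
  refine ⟨h v, (LinearEquiv.map_ne_zero_iff h).2 hv, fun a => ⟨g.symm a ⊗ₜ v, hU _, ?_⟩⟩
  simp

/-- A row of the classification follows from its validity for the representative. -/
lemma perpRow_of_rep {β₁ : LinearMap.BilinForm F (Fin 2 → F)}
    {β₂ : LinearMap.BilinForm F (Fin 3 → F)} (hn₁ : β₁.Nondegenerate) (hs₁ : β₁.IsSymm)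
    (hn₂ : β₂.Nondegenerate) (hs₂ : β₂.IsSymm) {L R : Submodule F (V F)}
    {P : Set (ℙ F (V F)) → Prop} {a b N : ℕ} (hP : ∀ g h S, P S → P (pmap g h '' S))
    (hL : stdPerp L = R) (hR : P (section23 R)) (hmin : HasMinSegre R a b)
    (hN : (section23 R).ncard = N) : PerpRow β₁ β₂ L R P a b N := by
  have hLR : R ∈ orb (perp β₁ β₂ L) := by
    rw [← hL]
    exact perp_mem_orb (stdForm_nondegenerate 2) (stdForm_isSymm 2) hn₁ hs₁
      (stdForm_nondegenerate 3) (stdForm_isSymm 3) hn₂ hs₂ (mem_orb_self L)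
  refine ⟨fun L' hL' => perp_mem_orb hn₁ hs₁ hn₁ hs₁ hn₂ hs₂ hn₂ hs₂ hL', hLR, ?_⟩
  rw [← orb_eq hLR]
  intro U hU
  refine ⟨?_, hmin.of_mem_orb hU, (ncard_section23_of_mem_orb hU).trans hN⟩
  obtain ⟨g, h, rfl⟩ := mem_orb.1 hU
  rw [← image_section23]
  exact hP _ _ _ hR

end

end Tensor23

namespace Tensor23

section

variable {F : Type*} [Field F]

/-! ### Counting points of rank one -/

/-- The space of all `b` with `a ⊗ b ∈ U`. -/
noncomputable def fiber (U : Submodule F (V F)) (a : Fin 2 → F) : Submodule F (Fin 3 → F) :=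
  U.comap (TensorProduct.mk F (Fin 2 → F) (Fin 3 → F) a)

lemma mem_fiber {U : Submodule F (V F)} {a : Fin 2 → F} {b : Fin 3 → F} :
    b ∈ fiber U a ↔ a ⊗ₜ[F] b ∈ U := Iff.rfl

/-- Representatives of the points of the projective line. -/
def dir : Option F → (Fin 2 → F)
  | none => ![0, 1]
  | some t => ![1, t]

lemma dir_ne_zero (o : Option F) : dir o ≠ 0 := by
  cases o with
  | none => exact fun h => one_ne_zero (congrFun h 1)
  | some t => exact fun h => one_ne_zero (congrFun h 0)

lemma dir_injective_of_mem_span {o o' : Option F} (h : dir o ∈ Submodule.span F {dir o'}) :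
    o = o' := by
  obtain ⟨c, hc⟩ := Submodule.mem_span_singleton.1 h
  have h0 := congrFun hc 0
  have h1 := congrFun hc 1
  cases o <;> cases o' <;> simp [dir] at h0 h1 ⊢
  · simp [h0] at h1
  · rw [← h1, h0, one_mul]

lemma exists_dir {a : Fin 2 → F} (ha : a ≠ 0) : ∃ (o : Option F) (c : F), c ≠ 0 ∧ a = c • dir o := by
  by_cases h0 : a 0 = 0
  · refine ⟨none, a 1, fun h1 => ha ?_, ?_⟩
    · ext i; fin_cases i <;> assumption
    · ext i; fin_cases i <;> simp [dir, h0]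
  · refine ⟨some (a 1 / a 0), a 0, h0, ?_⟩
    ext i; fin_cases i <;> simp [dir, mul_div_cancel₀ _ h0]

lemma mk_mem_section23 {U : Submodule F (V F)} {a : Fin 2 → F} {b : Fin 3 → F}
    (h : a ⊗ₜ[F] b ≠ 0) :
    Projectivization.mk F (a ⊗ₜ[F] b) h ∈ section23 U ↔ a ⊗ₜ[F] b ∈ U := by
  rw [section23, Set.mem_inter_iff, mk_mem_points]
  exact and_iff_left ⟨a, trivial, b, trivial, h, rfl⟩

/-- The points of rank one in `PG(U)` whose first factor is `dir o`. -/
noncomputable def fiberPoint (U : Submodule F (V F)) (p : Σ o : Option F, ℙ F (fiber U (dir o))) :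
    ℙ F (V F) :=
  Projectivization.map
    ((TensorProduct.mk F (Fin 2 → F) (Fin 3 → F) (dir p.1)).comp (fiber U (dir p.1)).subtype)
    ((injective_iff_map_eq_zero _).2 fun b hb => by
      by_contra h0
      exact tmul_ne_zero (dir_ne_zero p.1) (fun h => h0 (Subtype.ext h)) hb) p.2

/-- The first factor of a rank-one point is determined up to a scalar, which recovers `o`. For fixed
`o`, tensoring with `dir o` is an injective linear map. -/
lemma fiberPoint_injective (U : Submodule F (V F)) : Function.Injective (fiberPoint U) := by
  rintro ⟨o, p⟩ ⟨o', p'⟩ h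
  obtain rfl : o = o' := by
    induction p using Projectivization.ind with
    | h b hb =>
    induction p' using Projectivization.ind with
    | h b' hb' =>
    have hb0 : (b : Fin 3 → F) ≠ 0 := fun h => hb (Subtype.ext h)
    obtain ⟨c, hc⟩ := (Projectivization.mk_eq_mk_iff' F _ _ _ _).1 h
    refine dir_injective_of_mem_span (mem_of_tmul_mem
      (B := Submodule.span F {(b' : Fin 3 → F)}) (tmul_ne_zero (dir_ne_zero o) hb0) ?_).1
    have hc' : c • (dir o' ⊗ₜ[F] (b' : Fin 3 → F)) = dir o ⊗ₜ[F] (b : Fin 3 → F) := hc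
    rw [← hc']
    exact Submodule.smul_mem _ _ (tmul_mem_tensorSub (Submodule.mem_span_singleton_self _)
      (Submodule.mem_span_singleton_self _))
  exact congrArg (Sigma.mk o) (Projectivization.map_injective _ _ h)

lemma range_fiberPoint (U : Submodule F (V F)) : Set.range (fiberPoint U) = section23 U := by
  ext P
  constructor
  · rintro ⟨⟨o, p⟩, rfl⟩
    induction p using Projectivization.ind with
    | h b hb =>
    have hb0 : (b : Fin 3 → F) ≠ 0 := fun h => hb (Subtype.ext h)
    exact (mk_mem_section23 (tmul_ne_zero (dir_ne_zero o) hb0)).2 b.2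
  · intro hP
    obtain ⟨a, -, b, -, hab, rfl⟩ := hP.2
    rw [mk_mem_section23] at hP
    obtain ⟨o, c, hc, rfl⟩ := exists_dir (left_ne_zero hab)
    have hb : b ∈ fiber U (dir o) := by
      rw [mem_fiber]
      rw [← TensorProduct.smul_tmul'] at hP
      exact (U.smul_mem_iff hc).1 hP
    refine ⟨⟨o, Projectivization.mk F ⟨b, hb⟩ fun h => right_ne_zero hab (congrArg Subtype.val h)⟩, ?_⟩
    refine (Projectivization.mk_eq_mk_iff' F _ _ _ _).2 ⟨c⁻¹, ?_⟩
    rw [TensorProduct.smul_tmul', smul_smul, inv_mul_cancel₀ hc, one_smul]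
    rfl

/-- The rank-one points are fibred over the `q + 1` points of `PG(F²)`, with `(0, 1)` as the point
at infinity. Each fibre is a projective space, so every count below reduces to the rank of a linear
system in `b`. -/
lemma ncard_section23 [Fintype F] (U : Submodule F (V F)) :
    (section23 U).ncard =
      Nat.card (ℙ F (fiber U ![0, 1])) + ∑ t : F, Nat.card (ℙ F (fiber U ![1, t])) := by
  rw [← range_fiberPoint, ← Nat.card_coe_set_eq,
    Nat.card_range_of_injective (fiberPoint_injective U), Nat.card_sigma, Fintype.sum_option]
  rfl

variable [Finite F]

lemma card_of_eq_top {W : Submodule F (Fin 3 → F)} (h : ∀ b, b ∈ W) :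
    Nat.card (ℙ F W) = Nat.card F ^ 2 + Nat.card F + 1 := by
  have hW : W = ⊤ := by ext; simp [h]
  rw [Projectivization.card_of_finrank F W (n := 3) (by rw [hW, finrank_top]; simp)]
  simp [Finset.sum_range_succ]; ring

lemma card_of_dotProduct {W : Submodule F (Fin 3 → F)} {w : Fin 3 → F} (hw : w ≠ 0)
    (h : ∀ b, b ∈ W ↔ w ⬝ᵥ b = 0) : Nat.card (ℙ F W) = Nat.card F + 1 := by
  have hW : W = LinearMap.ker (stdForm F 3 w) := by ext b; exact h b
  refine Projectivization.card_of_finrank_two F W ?_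
  have hne : stdForm F 3 w ≠ 0 := fun h0 => hw <|
    (stdForm_nondegenerate 3).1 w fun b => by rw [h0]; rfl
  have := Module.Dual.finrank_ker_add_one_of_ne_zero hne
  rw [Module.finrank_fin_fun] at this
  rw [hW]
  lia

lemma card_of_span {W : Submodule F (Fin 3 → F)} {v : Fin 3 → F} (hv : v ≠ 0)
    (h : ∀ b, b ∈ W ↔ ∃ c : F, c • v = b) : Nat.card (ℙ F W) = 1 := by
  have hW : W = Submodule.span F {v} := by
    ext b; rw [h, Submodule.mem_span_singleton]
  rw [Projectivization.card_of_finrank F W (n := 1) (by rw [hW, finrank_span_singleton hv])]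
  simp

end

end Tensor23

/-! ### Linear equations of the representatives, their duality, and their numbers of rank-one
points. -/

namespace Tensor23

section

variable {F : Type*} [Field F]

/-! ### Equations of the representatives -/

/-- The representatives are spans of sets that are already subspaces, namely common kernels of two
functionals, so taking the span adds nothing. Hyperplanes are covered by `ψ = 0`. -/
lemma mem_span_iff_of_forall {S : Set (V F)} {φ ψ : V F →ₗ[F] F}
    (hS : ∀ x, x ∈ S ↔ φ x = 0 ∧ ψ x = 0) (x : V F) :
    x ∈ Submodule.span F S ↔ φ x = 0 ∧ ψ x = 0 := by
  have : Submodule.span F S = LinearMap.ker φ ⊓ LinearMap.ker ψ :=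
    le_antisymm (Submodule.span_le.2 fun y hy => (hS y).1 hy)
      fun y hy => Submodule.subset_span ((hS y).2 hy)
  rw [this]
  exact Iff.rfl

lemma mem_solid2 (x : V F) : x ∈ solid2 F ↔ coord 0 0 x = 0 ∧ coord 0 1 x = 0 := by
  refine mem_span_iff_of_forall (fun x => ⟨?_, fun h => ?_⟩) x
  · rintro ⟨x, y, z, w, rfl⟩; simp
  · refine ⟨coord 0 2 x, coord 1 0 x, coord 1 1 x, coord 1 2 x, ext_coord fun i j => ?_⟩
    fin_cases i <;> fin_cases j <;> simp [h]

lemma mem_solid4T (x : V F) : x ∈ solid4T F ↔ coord 0 0 x = 0 ∧ coord 1 0 x = 0 := by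
  refine mem_span_iff_of_forall (fun x => ⟨?_, fun h => ?_⟩) x
  · rintro ⟨x, y, z, w, rfl⟩; simp
  · refine ⟨coord 0 1 x, coord 0 2 x, coord 1 1 x, coord 1 2 x, ext_coord fun i j => ?_⟩
    fin_cases i <;> fin_cases j <;> simp [h]

lemma mem_solid5 (x : V F) : x ∈ solid5 F ↔ coord 0 0 x = 0 ∧ coord 1 1 x = 0 := by
  refine mem_span_iff_of_forall (fun x => ⟨?_, fun h => ?_⟩) x
  · rintro ⟨x, y, z, w, rfl⟩; simp
  · refine ⟨coord 0 1 x, coord 0 2 x, coord 1 0 x, coord 1 2 x, ext_coord fun i j => ?_⟩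
    fin_cases i <;> fin_cases j <;> simp [h]

lemma mem_solid6 (x : V F) : x ∈ solid6 F ↔ coord 1 0 x = 0 ∧ coord 0 0 x + coord 1 1 x = 0 := by
  refine mem_span_iff_of_forall (ψ := coord 0 0 + coord 1 1) (fun x => ⟨?_, fun h => ?_⟩) x
  · rintro ⟨x, y, z, w, rfl⟩; simp
  · refine ⟨coord 0 0 x, coord 0 1 x, coord 0 2 x, coord 1 2 x, ext_coord fun i j => ?_⟩
    have h2 : coord 0 0 x + coord 1 1 x = 0 := h.2
    fin_cases i <;> fin_cases j <;> simp [h.1]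
    linear_combination h2

lemma mem_solid7 (x : V F) : x ∈ solid7 F ↔ coord 0 1 x = 0 ∧ coord 0 0 x + coord 1 2 x = 0 := by
  refine mem_span_iff_of_forall (ψ := coord 0 0 + coord 1 2) (fun x => ⟨?_, fun h => ?_⟩) x
  · rintro ⟨x, y, z, w, rfl⟩; simp
  · refine ⟨coord 0 0 x, coord 0 2 x, coord 1 0 x, coord 1 1 x, ext_coord fun i j => ?_⟩
    have h2 : coord 0 0 x + coord 1 2 x = 0 := h.2
    fin_cases i <;> fin_cases j <;> simp [h.1]
    linear_combination h2

lemma mem_solid10 (u v : F) (x : V F) : x ∈ solid10 u v ↔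
    coord 0 0 x + u * coord 0 1 x + coord 1 1 x = 0 ∧ coord 0 1 x + v * coord 1 0 x = 0 := by
  refine mem_span_iff_of_forall (φ := coord 0 0 + u • coord 0 1 + coord 1 1)
    (ψ := coord 0 1 + v • coord 1 0) (fun x => ⟨?_, fun h => ?_⟩) x
  · rintro ⟨x, y, z, w, rfl⟩
    constructor
    · simp; ring
    · simp
  · refine ⟨coord 0 0 x, coord 1 0 x, coord 0 2 x, coord 1 2 x, ext_coord fun i j => ?_⟩
    have h1 : coord 0 0 x + u * coord 0 1 x + coord 1 1 x = 0 := h.1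
    have h2 : coord 0 1 x + v * coord 1 0 x = 0 := h.2
    fin_cases i <;> fin_cases j <;> simp
    · linear_combination h2
    · linear_combination h1 - u * h2

lemma mem_solid11 (x : V F) : x ∈ solid11 F ↔
    coord 0 0 x + coord 1 1 x = 0 ∧ coord 0 1 x + coord 1 2 x = 0 := by
  refine mem_span_iff_of_forall (φ := coord 0 0 + coord 1 1)
    (ψ := coord 0 1 + coord 1 2) (fun x => ⟨?_, fun h => ?_⟩) x
  · rintro ⟨x, y, z, w, rfl⟩
    constructor <;> simp
  · refine ⟨coord 0 0 x, coord 0 1 x, coord 0 2 x, coord 1 0 x, ext_coord fun i j => ?_⟩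
    have h1 : coord 0 0 x + coord 1 1 x = 0 := h.1
    have h2 : coord 0 1 x + coord 1 2 x = 0 := h.2
    fin_cases i <;> fin_cases j <;> simp
    · linear_combination h1
    · linear_combination h2

lemma mem_hyp1 (x : V F) : x ∈ hyp1 F ↔ coord 0 0 x = 0 := by
  refine (mem_span_iff_of_forall (φ := coord 0 0) (ψ := 0) (fun x => ⟨?_, fun h => ?_⟩) x).trans
    (and_iff_left rfl)
  · rintro ⟨x, y, z, w, t, rfl⟩; simp
  · refine ⟨coord 0 1 x, coord 0 2 x, coord 1 0 x, coord 1 1 x, coord 1 2 x,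
      ext_coord fun i j => ?_⟩
    fin_cases i <;> fin_cases j <;> simp [h.1]

lemma mem_hyp4 (x : V F) : x ∈ hyp4 F ↔ coord 0 0 x + coord 1 1 x = 0 := by
  refine (mem_span_iff_of_forall (φ := coord 0 0 + coord 1 1) (ψ := 0)
    (fun x => ⟨?_, fun h => ?_⟩) x).trans (and_iff_left rfl)
  · rintro ⟨x, y, z, w, t, rfl⟩; simp
  · refine ⟨coord 0 0 x, coord 0 1 x, coord 0 2 x, coord 1 0 x, coord 1 2 x,
      ext_coord fun i j => ?_⟩
    have h1 : coord 0 0 x + coord 1 1 x = 0 := h.1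
    fin_cases i <;> fin_cases j <;> simp
    linear_combination h1

/-! ### Lines and points as spans -/

lemma span_param_eq (A B : V F) {f : F → F → V F} (hf : ∀ x y, f x y = x • A + y • B) :
    Submodule.span F {T | ∃ x y : F, T = f x y} = Submodule.span F {A, B} := by
  apply le_antisymm
  · rw [Submodule.span_le]
    rintro _ ⟨x, y, rfl⟩
    exact Submodule.mem_span_pair.2 ⟨x, y, (hf x y).symm⟩
  · rw [Submodule.span_le]
    rintro _ (rfl | rfl)
    · exact Submodule.subset_span ⟨1, 0, by simp [hf]⟩
    · exact Submodule.subset_span ⟨0, 1, by simp [hf]⟩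

lemma line2_eq : line2 F = Submodule.span F {E F 0 0, E F 0 1} :=
  span_param_eq _ _ fun x y => by simp [ofMat_eq, Fin.sum_univ_succ]

lemma line4T_eq : line4T F = Submodule.span F {E F 0 0, E F 1 0} :=
  span_param_eq _ _ fun x y => by simp [ofMat_eq, Fin.sum_univ_succ]

lemma line5_eq : line5 F = Submodule.span F {E F 0 0, E F 1 1} :=
  span_param_eq _ _ fun x y => by simp [ofMat_eq, Fin.sum_univ_succ]

lemma line6_eq : line6 F = Submodule.span F {E F 0 0 + E F 1 1, E F 1 0} :=
  span_param_eq _ _ fun x y => by simp [ofMat_eq, Fin.sum_univ_succ]; module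

lemma line7_eq : line7 F = Submodule.span F {E F 0 0 + E F 1 2, E F 0 1} :=
  span_param_eq _ _ fun x y => by simp [ofMat_eq, Fin.sum_univ_succ]; module

lemma line10_eq (u v : F) : line10 u v =
    Submodule.span F {E F 0 0 + u • E F 0 1 + E F 1 1, E F 0 1 + v • E F 1 0} :=
  span_param_eq _ _ fun x y => by simp [ofMat_eq, Fin.sum_univ_succ]; module

lemma line11_eq : line11 F = Submodule.span F {E F 0 0 + E F 1 1, E F 0 1 + E F 1 2} :=
  span_param_eq _ _ fun x y => by simp [ofMat_eq, Fin.sum_univ_succ]; module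

lemma pt1_eq : pt1 F = Submodule.span F {E F 0 0} := by
  rw [pt1]; congr 2; simp [ofMat_eq, Fin.sum_univ_succ]

lemma pt4_eq : pt4 F = Submodule.span F {E F 0 0 + E F 1 1} := by
  rw [pt4]; congr 2; simp [ofMat_eq, Fin.sum_univ_succ]

lemma mem_stdPerp_pair {A B x : V F} : x ∈ stdPerp (Submodule.span F {A, B}) ↔
    tensorForm F A x = 0 ∧ tensorForm F B x = 0 := by
  simp [mem_stdPerp_span]

lemma stdPerp_line2 : stdPerp (line2 F) = solid2 F := by
  ext x; simp [line2_eq, mem_stdPerp_pair, tensorForm_E, mem_solid2]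

lemma stdPerp_line4T : stdPerp (line4T F) = solid4T F := by
  ext x; simp [line4T_eq, mem_stdPerp_pair, tensorForm_E, mem_solid4T]

lemma stdPerp_line5 : stdPerp (line5 F) = solid5 F := by
  ext x; simp [line5_eq, mem_stdPerp_pair, tensorForm_E, mem_solid5]

lemma stdPerp_line6 : stdPerp (line6 F) = solid6 F := by
  ext x; simp [line6_eq, mem_stdPerp_pair, tensorForm_E, mem_solid6, and_comm]

lemma stdPerp_line7 : stdPerp (line7 F) = solid7 F := by
  ext x; simp [line7_eq, mem_stdPerp_pair, tensorForm_E, mem_solid7, and_comm]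

lemma stdPerp_line10 (u v : F) : stdPerp (line10 u v) = solid10 u v := by
  ext x; simp [line10_eq, mem_stdPerp_pair, tensorForm_E, mem_solid10]

lemma stdPerp_line11 : stdPerp (line11 F) = solid11 F := by
  ext x; simp [line11_eq, mem_stdPerp_pair, tensorForm_E, mem_solid11]

lemma stdPerp_pt1 : stdPerp (pt1 F) = hyp1 F := by
  ext x; simp [pt1_eq, mem_stdPerp_span, tensorForm_E, mem_hyp1]

lemma stdPerp_pt4 : stdPerp (pt4 F) = hyp4 F := by
  ext x; simp [pt4_eq, mem_stdPerp_span, tensorForm_E, mem_hyp4]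

/-! ### Numbers of points of rank one -/

lemma tmul_mem_solid2 {a : Fin 2 → F} {b : Fin 3 → F} :
    a ⊗ₜ[F] b ∈ solid2 F ↔ a 0 * b 0 = 0 ∧ a 0 * b 1 = 0 := mem_solid2 _

lemma tmul_mem_solid4T {a : Fin 2 → F} {b : Fin 3 → F} :
    a ⊗ₜ[F] b ∈ solid4T F ↔ a 0 * b 0 = 0 ∧ a 1 * b 0 = 0 := mem_solid4T _

lemma tmul_mem_solid5 {a : Fin 2 → F} {b : Fin 3 → F} :
    a ⊗ₜ[F] b ∈ solid5 F ↔ a 0 * b 0 = 0 ∧ a 1 * b 1 = 0 := mem_solid5 _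

lemma tmul_mem_solid6 {a : Fin 2 → F} {b : Fin 3 → F} :
    a ⊗ₜ[F] b ∈ solid6 F ↔ a 1 * b 0 = 0 ∧ a 0 * b 0 + a 1 * b 1 = 0 := mem_solid6 _

lemma tmul_mem_solid7 {a : Fin 2 → F} {b : Fin 3 → F} :
    a ⊗ₜ[F] b ∈ solid7 F ↔ a 0 * b 1 = 0 ∧ a 0 * b 0 + a 1 * b 2 = 0 := mem_solid7 _

lemma tmul_mem_solid10 {u v : F} {a : Fin 2 → F} {b : Fin 3 → F} : a ⊗ₜ[F] b ∈ solid10 u v ↔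
    a 0 * b 0 + u * (a 0 * b 1) + a 1 * b 1 = 0 ∧ a 0 * b 1 + v * (a 1 * b 0) = 0 :=
  mem_solid10 _ _ _

lemma tmul_mem_solid11 {a : Fin 2 → F} {b : Fin 3 → F} : a ⊗ₜ[F] b ∈ solid11 F ↔
    a 0 * b 0 + a 1 * b 1 = 0 ∧ a 0 * b 1 + a 1 * b 2 = 0 := mem_solid11 _

lemma tmul_mem_hyp1 {a : Fin 2 → F} {b : Fin 3 → F} :
    a ⊗ₜ[F] b ∈ hyp1 F ↔ a 0 * b 0 = 0 := mem_hyp1 _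

lemma tmul_mem_hyp4 {a : Fin 2 → F} {b : Fin 3 → F} :
    a ⊗ₜ[F] b ∈ hyp4 F ↔ a 0 * b 0 + a 1 * b 1 = 0 := mem_hyp4 _

/-- If `v l² + u v l - 1` has no root, then the associated binary form is anisotropic. -/
lemma Admissible.eq_zero {u v : F} (h : Admissible u v) {b c : F}
    (hbc : v * c ^ 2 + u * v * (b * c) - b ^ 2 = 0) : b = 0 ∧ c = 0 := by
  have hb : b = 0 := by
    by_contra hb
    refine h.2 (c / b) ?_
    field_simp
    linear_combination hbc
  subst hb
  have : v * c ^ 2 = 0 := by linear_combination hbc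
  exact ⟨rfl, by simpa [h.1] using this⟩

/-- For fixed `a` the two equations are a linear system in `b 0`, `b 1`. Up to sign, its determinant
is the anisotropic form of `Admissible.eq_zero` evaluated at `a`, so Cramer's rule forces both
unknowns to vanish. -/
lemma Admissible.mem_solid10 {u v : F} (h : Admissible u v) {a : Fin 2 → F} {b : Fin 3 → F}
    (ha : a ≠ 0) : a ⊗ₜ[F] b ∈ solid10 u v ↔ b 0 = 0 ∧ b 1 = 0 := by
  rw [tmul_mem_solid10]
  constructor
  · rintro ⟨h1, h2⟩
    have hD : v * a 1 ^ 2 + u * v * (a 0 * a 1) - a 0 ^ 2 ≠ 0 := fun hD => ha <| by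
      obtain ⟨h0, h1⟩ := h.eq_zero hD
      ext i; fin_cases i <;> assumption
    constructor <;> refine (mul_eq_zero.1 ?_).resolve_left hD
    · linear_combination (u * a 0 + a 1) * h2 - a 0 * h1
    · linear_combination v * a 1 * h1 - a 0 * h2
  · rintro ⟨h1, h2⟩; simp [h1, h2]

lemma vec_ne_zero {n : ℕ} {v : Fin n → F} (i : Fin n) (h : v i ≠ 0) : v ≠ 0 :=
  fun h0 => h (congrFun h0 i)

section

variable [Finite F]

lemma ncard_solid2 : (section23 (solid2 F)).ncard = Nat.card F ^ 2 + 2 * Nat.card F + 1 := by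
  have := Fintype.ofFinite F
  have h0 : Nat.card (ℙ F (fiber (solid2 F) ![0, 1])) = Nat.card F ^ 2 + Nat.card F + 1 :=
    card_of_eq_top fun b => by simp [mem_fiber, tmul_mem_solid2]
  have h1 : ∀ t : F, Nat.card (ℙ F (fiber (solid2 F) ![1, t])) = 1 := fun t =>
    card_of_span (v := ![0, 0, 1]) (vec_ne_zero 2 (by simp)) fun b => by
      simp [mem_fiber, tmul_mem_solid2, funext_iff, Fin.forall_fin_succ, eq_comm]
  rw [ncard_section23, h0]
  simp [h1]; ring

lemma ncard_solid4T : (section23 (solid4T F)).ncard = Nat.card F ^ 2 + 2 * Nat.card F + 1 := by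
  have := Fintype.ofFinite F
  have h0 : Nat.card (ℙ F (fiber (solid4T F) ![0, 1])) = Nat.card F + 1 :=
    card_of_dotProduct (w := ![1, 0, 0]) (vec_ne_zero 0 (by simp)) fun b => by
      simp [mem_fiber, tmul_mem_solid4T, dotProduct, Fin.sum_univ_succ]
  have h1 : ∀ t : F, Nat.card (ℙ F (fiber (solid4T F) ![1, t])) = Nat.card F + 1 := fun t =>
    card_of_dotProduct (w := ![1, 0, 0]) (vec_ne_zero 0 (by simp)) fun b => by
      simp +contextual [mem_fiber, tmul_mem_solid4T, dotProduct, Fin.sum_univ_succ]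
  rw [ncard_section23, h0]
  simp [h1]; ring

lemma ncard_solid5 : (section23 (solid5 F)).ncard = 3 * Nat.card F + 1 := by
  classical
  have := Fintype.ofFinite F
  have h0 : Nat.card (ℙ F (fiber (solid5 F) ![0, 1])) = Nat.card F + 1 :=
    card_of_dotProduct (w := ![0, 1, 0]) (vec_ne_zero 1 (by simp)) fun b => by
      simp [mem_fiber, tmul_mem_solid5, dotProduct, Fin.sum_univ_succ]
  -- Besides `(0, 1)`, only the direction `(1, 0)` makes one of the two equations vacuous and
  -- enlarges the fibre from a point to a line.
  have h1 : ∀ t : F, Nat.card (ℙ F (fiber (solid5 F) ![1, t])) =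
      (if t = 0 then Nat.card F else 0) + 1 := by
    intro t
    split_ifs with ht
    · exact card_of_dotProduct (w := ![1, 0, 0]) (vec_ne_zero 0 (by simp)) fun b => by
        simp [mem_fiber, tmul_mem_solid5, dotProduct, Fin.sum_univ_succ, ht]
    · exact card_of_span (v := ![0, 0, 1]) (vec_ne_zero 2 (by simp)) fun b => by
        simp [mem_fiber, tmul_mem_solid5, funext_iff, Fin.forall_fin_succ, eq_comm, ht]
  rw [ncard_section23, h0]
  simp [h1, Finset.sum_add_distrib]; ring

lemma ncard_solid6 : (section23 (solid6 F)).ncard = 2 * Nat.card F + 1 := by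
  classical
  have := Fintype.ofFinite F
  have h0 : Nat.card (ℙ F (fiber (solid6 F) ![0, 1])) = 1 :=
    card_of_span (v := ![0, 0, 1]) (vec_ne_zero 2 (by simp)) fun b => by
      simp [mem_fiber, tmul_mem_solid6, funext_iff, Fin.forall_fin_succ, eq_comm]
  have h1 : ∀ t : F, Nat.card (ℙ F (fiber (solid6 F) ![1, t])) =
      (if t = 0 then Nat.card F else 0) + 1 := by
    intro t
    split_ifs with ht
    · exact card_of_dotProduct (w := ![1, 0, 0]) (vec_ne_zero 0 (by simp)) fun b => by
        simp [mem_fiber, tmul_mem_solid6, dotProduct, Fin.sum_univ_succ, ht]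
    · exact card_of_span (v := ![0, 0, 1]) (vec_ne_zero 2 (by simp)) fun b => by
        simp +contextual [mem_fiber, tmul_mem_solid6, funext_iff, Fin.forall_fin_succ,
          eq_comm (a := (0 : F)), ht]
  rw [ncard_section23, h0]
  simp [h1, Finset.sum_add_distrib]; ring

lemma ncard_solid7 : (section23 (solid7 F)).ncard = 2 * Nat.card F + 1 := by
  have := Fintype.ofFinite F
  have h0 : Nat.card (ℙ F (fiber (solid7 F) ![0, 1])) = Nat.card F + 1 :=
    card_of_dotProduct (w := ![0, 0, 1]) (vec_ne_zero 2 (by simp)) fun b => by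
      simp [mem_fiber, tmul_mem_solid7, dotProduct, Fin.sum_univ_succ]
  have h1 : ∀ t : F, Nat.card (ℙ F (fiber (solid7 F) ![1, t])) = 1 := fun t =>
    card_of_span (v := ![-t, 0, 1]) (vec_ne_zero 2 (by simp)) fun b => by
      simp only [mem_fiber, tmul_mem_solid7]
      constructor
      · rintro ⟨h1, h2⟩
        simp at h1 h2
        refine ⟨b 2, ?_⟩
        ext i; fin_cases i <;> simp [h1]
        linear_combination -h2
      · rintro ⟨c, rfl⟩; simp; ring
  rw [ncard_section23, h0]
  simp [h1]; ring

lemma ncard_solid10 {u v : F} (h : Admissible u v) :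
    (section23 (solid10 u v)).ncard = Nat.card F + 1 := by
  have := Fintype.ofFinite F
  have h0 : ∀ a : Fin 2 → F, a ≠ 0 → Nat.card (ℙ F (fiber (solid10 u v) a)) = 1 := fun a ha =>
    card_of_span (v := ![0, 0, 1]) (vec_ne_zero 2 (by simp)) fun b => by
      simp [mem_fiber, h.mem_solid10 ha, funext_iff, Fin.forall_fin_succ, eq_comm]
  rw [ncard_section23, h0 _ (vec_ne_zero 1 (by simp))]
  simp [h0 _ (vec_ne_zero 0 (by simp : ![1, _] 0 ≠ (0 : F)))]; ring

lemma ncard_solid11 : (section23 (solid11 F)).ncard = Nat.card F + 1 := by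
  have := Fintype.ofFinite F
  have h0 : Nat.card (ℙ F (fiber (solid11 F) ![0, 1])) = 1 :=
    card_of_span (v := ![1, 0, 0]) (vec_ne_zero 0 (by simp)) fun b => by
      simp [mem_fiber, tmul_mem_solid11, funext_iff, Fin.forall_fin_succ, eq_comm]
  -- The equations `b 0 = -t * b 1` and `b 1 = -t * b 2` leave the single point `(t², -t, 1)`.
  have h1 : ∀ t : F, Nat.card (ℙ F (fiber (solid11 F) ![1, t])) = 1 := fun t =>
    card_of_span (v := ![t ^ 2, -t, 1]) (vec_ne_zero 2 (by simp)) fun b => by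
      simp only [mem_fiber, tmul_mem_solid11]
      constructor
      · rintro ⟨h1, h2⟩
        simp at h1 h2
        refine ⟨b 2, ?_⟩
        ext i; fin_cases i <;> simp
        · linear_combination t * h2 - h1
        · linear_combination -h2
      · rintro ⟨c, rfl⟩
        constructor
        · simp; ring
        · simp; ring
  rw [ncard_section23, h0]
  simp [h1]; ring

lemma ncard_hyp1 : (section23 (hyp1 F)).ncard = 2 * Nat.card F ^ 2 + 2 * Nat.card F + 1 := by
  have := Fintype.ofFinite F
  have h0 : Nat.card (ℙ F (fiber (hyp1 F) ![0, 1])) = Nat.card F ^ 2 + Nat.card F + 1 :=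
    card_of_eq_top fun b => by simp [mem_fiber, tmul_mem_hyp1]
  have h1 : ∀ t : F, Nat.card (ℙ F (fiber (hyp1 F) ![1, t])) = Nat.card F + 1 := fun t =>
    card_of_dotProduct (w := ![1, 0, 0]) (vec_ne_zero 0 (by simp)) fun b => by
      simp [mem_fiber, tmul_mem_hyp1, dotProduct, Fin.sum_univ_succ]
  rw [ncard_section23, h0]
  simp [h1]; ring

lemma ncard_hyp4 : (section23 (hyp4 F)).ncard = (Nat.card F + 1) ^ 2 := by
  have := Fintype.ofFinite F
  have h0 : Nat.card (ℙ F (fiber (hyp4 F) ![0, 1])) = Nat.card F + 1 :=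
    card_of_dotProduct (w := ![0, 1, 0]) (vec_ne_zero 1 (by simp)) fun b => by
      simp [mem_fiber, tmul_mem_hyp4, dotProduct, Fin.sum_univ_succ]
  have h1 : ∀ t : F, Nat.card (ℙ F (fiber (hyp4 F) ![1, t])) = Nat.card F + 1 := fun t =>
    card_of_dotProduct (w := ![1, t, 0]) (vec_ne_zero 0 (by simp)) fun b => by
      simp [mem_fiber, tmul_mem_hyp4, dotProduct, Fin.sum_univ_succ]
  rw [ncard_section23, h0]
  simp [h1]; ring

end

end

end Tensor23

/-! ### Geometry of the representatives: minimal Segre varieties, sections, and lines `PG(F² ⊗ v)`.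
-/

namespace Tensor23

section

variable {F : Type*} [Field F]

/-! ### Minimal Segre varieties of the representatives -/

/-- Columns of tensors in `A' ⊗ B'` lie in `A'`, and rows lie in `B'`. So it suffices that one
column of the members of `U` fills `F²` and that the rows together fill `F³`. A sum of two rows is
allowed because for some representatives neither row alone suffices. -/
lemma hasMinSegre_two_three {U : Submodule F (V F)} (j : Fin 3) (hcol : ∀ a, ∃ x ∈ U, col j x = a)
    (hrow : ∀ b, ∃ x ∈ U, ∃ y ∈ U, row 0 x + row 1 y = b) : HasMinSegre U 2 3 := by
  refine ⟨⊤, ⊤, by simp, by simp, ?_, fun A' B' h => ⟨fun a _ => ?_, fun b _ => ?_⟩⟩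
  · intro x _
    obtain ⟨r, s, rfl⟩ := eq_add_tmul x
    exact Submodule.add_mem _ (tmul_mem_tensorSub trivial trivial)
      (tmul_mem_tensorSub trivial trivial)
  · obtain ⟨x, hx, rfl⟩ := hcol a
    exact col_mem (h hx) j
  · obtain ⟨x, hx, y, hy, rfl⟩ := hrow b
    exact B'.add_mem (row_mem (h hx) 0) (row_mem (h hy) 1)

lemma row_ofMat (M : Matrix (Fin 2) (Fin 3) F) (i : Fin 2) : row i (ofMat M) = M i :=
  funext fun j => coord_ofMat M i j

lemma col_ofMat (M : Matrix (Fin 2) (Fin 3) F) (j : Fin 3) :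
    col j (ofMat M) = fun i => M i j :=
  funext fun i => coord_ofMat M i j

lemma hasMinSegre_solid2 : HasMinSegre (solid2 F) 2 3 := by
  refine hasMinSegre_two_three 2 (fun a => ⟨ofMat !![0, 0, a 0; 0, 0, a 1], ?_, ?_⟩)
    fun b => ⟨0, zero_mem _, ofMat !![0, 0, 0; b 0, b 1, b 2], ?_, ?_⟩
  · simp [mem_solid2]
  · ext i; fin_cases i <;> simp [col_ofMat]
  · simp [mem_solid2]
  · ext i; fin_cases i <;> simp [row_ofMat]

lemma hasMinSegre_solid5 : HasMinSegre (solid5 F) 2 3 := by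
  refine hasMinSegre_two_three 2 (fun a => ⟨ofMat !![0, 0, a 0; 0, 0, a 1], ?_, ?_⟩)
    fun b => ⟨ofMat !![0, b 1, b 2; 0, 0, 0], ?_, ofMat !![0, 0, 0; b 0, 0, 0], ?_, ?_⟩
  · simp [mem_solid5]
  · ext i; fin_cases i <;> simp [col_ofMat]
  · simp [mem_solid5]
  · simp [mem_solid5]
  · ext i; fin_cases i <;> simp [row_ofMat]

lemma hasMinSegre_solid6 : HasMinSegre (solid6 F) 2 3 := by
  refine hasMinSegre_two_three 2 (fun a => ⟨ofMat !![0, 0, a 0; 0, 0, a 1], ?_, ?_⟩)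
    fun b => ⟨ofMat !![b 0, b 1, b 2; 0, -b 0, 0], ?_, 0, zero_mem _, ?_⟩
  · simp [mem_solid6]
  · ext i; fin_cases i <;> simp [col_ofMat]
  · simp [mem_solid6]
  · ext i; fin_cases i <;> simp [row_ofMat]

lemma hasMinSegre_solid7 : HasMinSegre (solid7 F) 2 3 := by
  refine hasMinSegre_two_three 0 (fun a => ⟨ofMat !![a 0, 0, 0; a 1, 0, -a 0], ?_, ?_⟩)
    fun b => ⟨0, zero_mem _, ofMat !![-b 2, 0, 0; b 0, b 1, b 2], ?_, ?_⟩
  · simp [mem_solid7]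
  · ext i; fin_cases i <;> simp [col_ofMat]
  · simp [mem_solid7]
  · ext i; fin_cases i <;> simp [row_ofMat]

lemma hasMinSegre_solid10 {u v : F} (hv : v ≠ 0) : HasMinSegre (solid10 u v) 2 3 := by
  refine hasMinSegre_two_three 2 (fun a => ⟨ofMat !![0, 0, a 0; 0, 0, a 1], ?_, ?_⟩)
    fun b => ⟨ofMat !![b 0, b 1, b 2; -(b 1 / v), -b 0 - u * b 1, 0], ?_, 0, zero_mem _, ?_⟩
  · simp [mem_solid10]
  · ext i; fin_cases i <;> simp [col_ofMat]
  · simp only [mem_solid10, coord_ofMat]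
    simp [mul_div_cancel₀ _ hv]
  · ext i; fin_cases i <;> simp [row_ofMat]

lemma hasMinSegre_solid11 : HasMinSegre (solid11 F) 2 3 := by
  refine hasMinSegre_two_three 0 (fun a => ⟨ofMat !![a 0, 0, 0; a 1, -a 0, 0], ?_, ?_⟩)
    fun b => ⟨ofMat !![b 0, b 1, b 2; 0, -b 0, -b 1], ?_, 0, zero_mem _, ?_⟩
  · simp [mem_solid11]
  · ext i; fin_cases i <;> simp [col_ofMat]
  · simp [mem_solid11]
  · ext i; fin_cases i <;> simp [row_ofMat]

lemma hasMinSegre_hyp1 : HasMinSegre (hyp1 F) 2 3 := by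
  refine hasMinSegre_two_three 2 (fun a => ⟨ofMat !![0, 0, a 0; 0, 0, a 1], ?_, ?_⟩)
    fun b => ⟨0, zero_mem _, ofMat !![0, 0, 0; b 0, b 1, b 2], ?_, ?_⟩
  · simp [mem_hyp1]
  · ext i; fin_cases i <;> simp [col_ofMat]
  · simp [mem_hyp1]
  · ext i; fin_cases i <;> simp [row_ofMat]

lemma hasMinSegre_hyp4 : HasMinSegre (hyp4 F) 2 3 := by
  refine hasMinSegre_two_three 2 (fun a => ⟨ofMat !![0, 0, a 0; 0, 0, a 1], ?_, ?_⟩)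
    fun b => ⟨ofMat !![b 0, b 1, b 2; 0, -b 0, 0], ?_, 0, zero_mem _, ?_⟩
  · simp [mem_hyp4]
  · ext i; fin_cases i <;> simp [col_ofMat]
  · simp [mem_hyp4]
  · ext i; fin_cases i <;> simp [row_ofMat]

/-- The vectors whose `j`-th coordinate vanishes. -/
noncomputable def coordKer (F : Type*) [Field F] {n : ℕ} (j : Fin n) : Submodule F (Fin n → F) :=
  LinearMap.ker (LinearMap.proj j)

lemma mem_coordKer {n : ℕ} {j : Fin n} {x : Fin n → F} : x ∈ coordKer F j ↔ x j = 0 := Iff.rfl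

lemma finrank_coordKer {n : ℕ} (j : Fin n) : Module.finrank F (coordKer F j) = n - 1 := by
  have hne : (LinearMap.proj j : (Fin n → F) →ₗ[F] F) ≠ 0 := fun h => by
    simpa using LinearMap.congr_fun h (Pi.single j 1)
  have := Module.Dual.finrank_ker_add_one_of_ne_zero hne
  rw [Module.finrank_fin_fun] at this
  rw [coordKer]
  lia

lemma mem_span_stdVec {n : ℕ} {j : Fin n} {x : Fin n → F} :
    x ∈ Submodule.span F {stdVec F j} ↔ ∀ i, i ≠ j → x i = 0 := by
  rw [Submodule.mem_span_singleton]
  constructor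
  · rintro ⟨c, rfl⟩ i hi
    simp [hi]
  · intro h
    refine ⟨x j, ?_⟩
    ext i
    by_cases hi : i = j
    · subst hi; simp
    · simp [hi, h i hi]

lemma finrank_span_stdVec {n : ℕ} (j : Fin n) :
    Module.finrank F (Submodule.span F {stdVec F j}) = 1 :=
  finrank_span_singleton (by simp)

lemma hasMinSegre_solid4T : HasMinSegre (solid4T F) 2 2 := by
  refine ⟨⊤, coordKer F 0, by simp, finrank_coordKer 0, ?_, fun A' B' h => ⟨fun a _ => ?_,
    fun b hb => ?_⟩⟩
  · intro x hx
    rw [mem_solid4T] at hx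
    obtain ⟨r, s, rfl⟩ := eq_add_tmul x
    refine Submodule.add_mem _ (tmul_mem_tensorSub trivial ?_) (tmul_mem_tensorSub trivial ?_)
    · simpa [mem_coordKer] using hx.1
    · simpa [mem_coordKer] using hx.2
  · have hx : ofMat !![0, a 0, 0; 0, a 1, 0] ∈ solid4T F := by simp [mem_solid4T]
    convert col_mem (h hx) 1 using 1
    ext i; fin_cases i <;> simp [col_ofMat]
  · have hx : ofMat !![0, b 1, b 2; 0, 0, 0] ∈ solid4T F := by simp [mem_solid4T]
    convert row_mem (h hx) 0 using 1
    rw [mem_coordKer] at hb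
    ext i; fin_cases i <;> simp [row_ofMat, hb]

/-! ### Sections of the representatives -/

lemma mk_mem_segreSet {A : Submodule F (Fin 2 → F)} {B : Submodule F (Fin 3 → F)}
    {a : Fin 2 → F} {b : Fin 3 → F} (h : a ⊗ₜ[F] b ≠ 0) :
    Projectivization.mk F (a ⊗ₜ[F] b) h ∈ segreSet A B ↔ a ∈ A ∧ b ∈ B := by
  constructor
  · rintro ⟨a', ha', b', hb', h', heq⟩
    obtain ⟨c, hc⟩ := (Projectivization.mk_eq_mk_iff' F _ _ _ _).1 heq
    refine mem_of_tmul_mem h ?_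
    rw [← hc]
    exact Submodule.smul_mem _ _ (tmul_mem_tensorSub ha' hb')
  · rintro ⟨ha, hb⟩
    exact ⟨a, ha, b, hb, h, rfl⟩

lemma segreSet_subset_segre (A : Submodule F (Fin 2 → F)) (B : Submodule F (Fin 3 → F)) :
    segreSet A B ⊆ segre F := by
  rintro _ ⟨a, -, b, -, h, rfl⟩
  exact ⟨a, trivial, b, trivial, h, rfl⟩

lemma segreSet_inter (A A' : Submodule F (Fin 2 → F)) (B B' : Submodule F (Fin 3 → F)) :
    segreSet A B ∩ segreSet A' B' = segreSet (A ⊓ A') (B ⊓ B') := by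
  ext P
  constructor
  · rintro ⟨⟨a, ha, b, hb, h, rfl⟩, hP⟩
    obtain ⟨ha', hb'⟩ := (mk_mem_segreSet h).1 hP
    exact ⟨a, ⟨ha, ha'⟩, b, ⟨hb, hb'⟩, h, rfl⟩
  · rintro ⟨a, ha, b, hb, h, rfl⟩
    exact ⟨⟨a, ha.1, b, hb.1, h, rfl⟩, ⟨a, ha.2, b, hb.2, h, rfl⟩⟩

lemma segreSet_nonempty {A : Submodule F (Fin 2 → F)} {B : Submodule F (Fin 3 → F)}
    {a : Fin 2 → F} {b : Fin 3 → F} (ha : a ∈ A) (ha0 : a ≠ 0) (hb : b ∈ B) (hb0 : b ≠ 0) :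
    (segreSet A B).Nonempty :=
  ⟨_, a, ha, b, hb, tmul_ne_zero ha0 hb0, rfl⟩

/-- Both sets consist of rank-one points, so only pure tensors have to be compared. For sections
that are unions of sub-Segre varieties this leaves a propositional statement about vanishing
coordinates. -/
lemma section23_eq {U : Submodule F (V F)} {S : Set (ℙ F (V F))} (hS : S ⊆ segre F)
    (h : ∀ (a : Fin 2 → F) (b : Fin 3 → F) (hab : a ⊗ₜ[F] b ≠ 0),
      a ⊗ₜ[F] b ∈ U ↔ Projectivization.mk F (a ⊗ₜ[F] b) hab ∈ S) : section23 U = S := by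
  ext P
  constructor
  · intro hP
    obtain ⟨a, -, b, -, hab, rfl⟩ := hP.2
    exact (h a b hab).1 ((mk_mem_section23 hab).1 hP)
  · intro hP
    obtain ⟨a, -, b, -, hab, rfl⟩ := hS hP
    exact (mk_mem_section23 hab).2 ((h a b hab).2 hP)

lemma coord_ne_zero_or {a : Fin 2 → F} (ha : a ≠ 0) : a 0 ≠ 0 ∨ a 1 ≠ 0 := by
  by_contra! h
  exact ha (by ext i; fin_cases i; exacts [h.1, h.2])

lemma isPlaneAndLine_solid2 : IsPlaneAndLine (section23 (solid2 F)) := by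
  refine ⟨segreSet (Submodule.span F {stdVec F 1}) ⊤, segreSet ⊤ (Submodule.span F {stdVec F 2}),
    ⟨_, _, finrank_span_stdVec _, by simp, rfl⟩, ⟨_, _, by simp, finrank_span_stdVec _, rfl⟩,
    section23_eq (Set.union_subset (segreSet_subset_segre _ _) (segreSet_subset_segre _ _))
      fun a b hab => ?_⟩
  rw [Set.mem_union, mk_mem_segreSet, mk_mem_segreSet, mem_span_stdVec, mem_span_stdVec,
    tmul_mem_solid2]
  simp [Fin.forall_fin_succ]
  tauto

lemma isSubSegre_solid4T : IsSubSegre 2 2 (section23 (solid4T F)) := by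
  refine ⟨⊤, coordKer F 0, by simp, finrank_coordKer _,
    section23_eq (segreSet_subset_segre _ _) fun a b hab => ?_⟩
  rw [mk_mem_segreSet, tmul_mem_solid4T, mem_coordKer]
  have := coord_ne_zero_or (left_ne_zero hab)
  simp
  tauto

lemma isThreeLines_solid5 : IsThreeLines (section23 (solid5 F)) := by
  refine ⟨segreSet ⊤ (Submodule.span F {stdVec F 2}),
    segreSet (Submodule.span F {stdVec F 1}) (coordKer F 1),
    segreSet (Submodule.span F {stdVec F 0}) (coordKer F 0),
    ⟨_, _, by simp, finrank_span_stdVec _, rfl⟩,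
    ⟨_, _, finrank_span_stdVec _, finrank_coordKer _, rfl⟩,
    ⟨_, _, finrank_span_stdVec _, finrank_coordKer _, rfl⟩, ?_, ?_, ?_,
    section23_eq (Set.union_subset (Set.union_subset (segreSet_subset_segre _ _)
      (segreSet_subset_segre _ _)) (segreSet_subset_segre _ _)) fun a b hab => ?_⟩
  · rw [Set.disjoint_iff_inter_eq_empty, segreSet_inter, Set.eq_empty_iff_forall_notMem]
    rintro _ ⟨a, ⟨ha, ha'⟩, b, -, hab, rfl⟩
    rw [SetLike.mem_coe, mem_span_stdVec] at ha ha'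
    simp [Fin.forall_fin_succ] at ha ha'
    exact (coord_ne_zero_or (left_ne_zero hab)).elim (· ha) (· ha')
  · rw [segreSet_inter]
    exact segreSet_nonempty (a := stdVec F 1) (b := stdVec F 2)
      ⟨trivial, Submodule.mem_span_singleton_self _⟩ (by simp)
      ⟨Submodule.mem_span_singleton_self _, by simp [mem_coordKer]⟩ (by simp)
  · rw [segreSet_inter]
    exact segreSet_nonempty (a := stdVec F 0) (b := stdVec F 2)
      ⟨trivial, Submodule.mem_span_singleton_self _⟩ (by simp)
      ⟨Submodule.mem_span_singleton_self _, by simp [mem_coordKer]⟩ (by simp)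
  · rw [Set.mem_union, Set.mem_union, mk_mem_segreSet, mk_mem_segreSet, mk_mem_segreSet,
      mem_span_stdVec, mem_span_stdVec, mem_span_stdVec, tmul_mem_solid5]
    have := coord_ne_zero_or (left_ne_zero hab)
    simp [Fin.forall_fin_succ, mem_coordKer]
    tauto

lemma isTwoLines_solid6 : IsTwoLines (section23 (solid6 F)) := by
  refine ⟨segreSet ⊤ (Submodule.span F {stdVec F 2}),
    segreSet (Submodule.span F {stdVec F 0}) (coordKer F 0),
    ⟨_, _, by simp, finrank_span_stdVec _, rfl⟩,
    ⟨_, _, finrank_span_stdVec _, finrank_coordKer _, rfl⟩, ?_,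
    section23_eq (Set.union_subset (segreSet_subset_segre _ _) (segreSet_subset_segre _ _))
      fun a b hab => ?_⟩
  · rw [segreSet_inter]
    exact segreSet_nonempty (a := stdVec F 0) (b := stdVec F 2)
      ⟨trivial, Submodule.mem_span_singleton_self _⟩ (by simp)
      ⟨Submodule.mem_span_singleton_self _, by simp [mem_coordKer]⟩ (by simp)
  · rw [Set.mem_union, mk_mem_segreSet, mk_mem_segreSet, mem_span_stdVec, mem_span_stdVec,
      tmul_mem_solid6]
    have := coord_ne_zero_or (left_ne_zero hab)
    by_cases h0 : b 0 = 0
    · simp [Fin.forall_fin_succ, mem_coordKer, h0]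
      tauto
    · simp +contextual [Fin.forall_fin_succ, mem_coordKer, h0]
      tauto

lemma isSubSegre_solid10 {u v : F} (h : Admissible u v) :
    IsSubSegre 2 1 (section23 (solid10 u v)) := by
  refine ⟨⊤, Submodule.span F {stdVec F 2}, by simp, finrank_span_stdVec _,
    section23_eq (segreSet_subset_segre _ _) fun a b hab => ?_⟩
  rw [mk_mem_segreSet, h.mem_solid10 (left_ne_zero hab), mem_span_stdVec]
  simp [Fin.forall_fin_succ]

lemma isPlaneAndS22_hyp1 : IsPlaneAndS22 (section23 (hyp1 F)) := by
  refine ⟨segreSet (Submodule.span F {stdVec F 1}) ⊤, segreSet ⊤ (coordKer F 0),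
    ⟨_, _, finrank_span_stdVec _, by simp, rfl⟩, ⟨_, _, by simp, finrank_coordKer _, rfl⟩, ?_,
    section23_eq (Set.union_subset (segreSet_subset_segre _ _) (segreSet_subset_segre _ _))
      fun a b hab => ?_⟩
  · rw [segreSet_inter, inf_top_eq, top_inf_eq]
    exact ⟨_, _, finrank_span_stdVec _, finrank_coordKer _, rfl⟩
  · rw [Set.mem_union, mk_mem_segreSet, mk_mem_segreSet, mem_span_stdVec, tmul_mem_hyp1]
    simp [Fin.forall_fin_succ, mem_coordKer]

lemma paramSet_subset_section23 {X : Type*} {φ : X → V F} {f : X → Fin 2 → F} {k : X → Fin 3 → F}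
    (hφ : ∀ x, φ x = f x ⊗ₜ k x) {U : Submodule F (V F)} (hU : ∀ x, φ x ∈ U) :
    paramSet φ ⊆ section23 U := by
  rintro _ ⟨x, hx, rfl⟩
  refine ⟨(mk_mem_points hx).2 (hU x), f x, trivial, k x, trivial, hφ x ▸ hx, ?_⟩
  simp only [hφ]

lemma mk_mem_paramSet {X : Type*} {φ : X → V F} {x : V F} (hx : x ≠ 0) (p : X) (c : F)
    (h : c • φ p = x) : Projectivization.mk F x hx ∈ paramSet φ := by
  have hp : φ p ≠ 0 := by
    intro h0
    exact hx (by rw [← h, h0, smul_zero])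
  exact ⟨p, hp, (Projectivization.mk_eq_mk_iff' F _ _ _ _).2 ⟨c, h⟩⟩

lemma linearIndependent_of_coord {n : ℕ} {c : Fin n → V F}
    (h : ∀ g : Fin n → F, (∀ i j, coord i j (∑ k, g k • c k) = 0) → ∀ k, g k = 0) :
    LinearIndependent F c :=
  Fintype.linearIndependent_iff.2 fun g hg => h g fun i j => by rw [hg, map_zero]

/-- If `a 0 ≠ 0`, the equations force `b` to be proportional to `(a 1, 0, -a 0)`, so `a ⊗ b` is
quadratic in `a` and lies on a conic. If `a 0 = 0`, the only condition left is `b 2 = 0`, which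
gives the line. -/
lemma isConicAndLine_solid7 : IsConicAndLine (section23 (solid7 F)) := by
  have hφ : ∀ p : F × F, ∑ i : Fin 3, (p.1 ^ (2 - (i : ℕ)) * p.2 ^ (i : ℕ)) •
      (![-E F 0 2, E F 0 0 - E F 1 2, E F 1 0] i) = ![p.1, p.2] ⊗ₜ[F] ![p.2, 0, -p.1] := by
    intro p
    refine ext_coord fun i j => ?_
    fin_cases i <;> fin_cases j <;> simp [Fin.sum_univ_succ] <;> ring
  refine ⟨_, segreSet (Submodule.span F {stdVec F 1}) (coordKer F 2),
    isNormalRationalCurve_iff.2 ⟨![-E F 0 2, E F 0 0 - E F 1 2, E F 1 0], ?_, rfl⟩,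
    ⟨_, _, finrank_span_stdVec _, finrank_coordKer _, rfl⟩, Set.Subset.antisymm ?_ ?_⟩
  · refine linearIndependent_of_coord fun g hg => ?_
    have h0 := hg 0 2
    have h1 := hg 0 0
    have h2 := hg 1 0
    simp [Fin.sum_univ_succ] at h0 h1 h2
    intro k; fin_cases k <;> simp [*]
  · intro P hP
    obtain ⟨a, -, b, -, hab, rfl⟩ := hP.2
    rw [mk_mem_section23, tmul_mem_solid7] at hP
    by_cases h0 : a 0 = 0
    · refine Or.inr ((mk_mem_segreSet hab).2 ⟨?_, ?_⟩)
      · simp [mem_span_stdVec, Fin.forall_fin_succ, h0]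
      · have := coord_ne_zero_or (left_ne_zero hab)
        simp [h0] at this hP
        rw [mem_coordKer]; tauto
    · refine Or.inl (mk_mem_paramSet hab (a 0, a 1) (-b 2 / a 0) ?_)
      rw [hφ, TensorProduct.smul_tmul']
      simp [h0] at hP
      have hb : b 0 = - (a 1 * b 2) / a 0 := by field_simp; linear_combination hP.2
      refine ext_coord fun i j => ?_
      fin_cases i <;> fin_cases j <;> simp [hP.1, hb] <;> field_simp
  · refine Set.union_subset (paramSet_subset_section23 hφ fun p => ?_) ?_
    · rw [hφ, tmul_mem_solid7]
      simp; ring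
    · rintro _ ⟨a, ha, b, hb, hab, rfl⟩
      rw [mk_mem_section23, tmul_mem_solid7]
      simp [mem_span_stdVec, Fin.forall_fin_succ] at ha
      rw [mem_coordKer] at hb
      simp [ha, hb]

/-- The parametrization of the twisted cubic in `solid11`. -/
lemma section23_solid11 : section23 (solid11 F) =
    paramSet fun p : F × F => ![p.1, p.2] ⊗ₜ[F] ![p.2 ^ 2, -(p.1 * p.2), p.1 ^ 2] := by
  apply Set.Subset.antisymm
  · intro P hP
    obtain ⟨a, -, b, -, hab, rfl⟩ := hP.2
    rw [mk_mem_section23, tmul_mem_solid11] at hP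
    obtain ⟨h1, h2⟩ := hP
    -- For given `a` the solutions `b` are the multiples of `(a 1 ^ 2, -(a 0 * a 1), a 0 ^ 2)`. The
    -- multiplier is read from the first or the last coordinate, whichever is nonzero.
    by_cases h0 : a 0 = 0
    · have ha1 : a 1 ≠ 0 := (coord_ne_zero_or (left_ne_zero hab)).resolve_left (· h0)
      simp [h0, ha1] at h1 h2
      refine mk_mem_paramSet hab (a 0, a 1) (b 0 / a 1 ^ 2) ?_
      refine ext_coord fun i j => ?_
      fin_cases i <;> fin_cases j <;> simp [h0, h1, h2]
      field_simp
    · refine mk_mem_paramSet hab (a 0, a 1) (b 2 / a 0 ^ 2) ?_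
      have hb1 : b 1 = - (a 1 * b 2) / a 0 := by field_simp; linear_combination h2
      have hb0 : b 0 = a 1 ^ 2 * b 2 / a 0 ^ 2 := by
        rw [hb1] at h1; field_simp at h1 ⊢; linear_combination h1
      refine ext_coord fun i j => ?_
      fin_cases i <;> fin_cases j <;> simp [hb0, hb1] <;> field_simp
  · refine paramSet_subset_section23 (fun _ => rfl) fun p => ?_
    rw [tmul_mem_solid11]
    constructor <;> simp <;> ring

lemma isNormalRationalCurve_three_solid11 : IsNormalRationalCurve 3 (section23 (solid11 F)) := by
  rw [section23_solid11]
  refine isNormalRationalCurve_iff.2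
    ⟨![E F 0 2, E F 1 2 - E F 0 1, E F 0 0 - E F 1 1, E F 1 0], ?_, congrArg paramSet ?_⟩
  · refine linearIndependent_of_coord fun g hg => ?_
    have h0 := hg 0 2
    have h1 := hg 1 2
    have h2 := hg 0 0
    have h3 := hg 1 0
    simp [Fin.sum_univ_succ] at h0 h1 h2 h3
    intro k; fin_cases k <;> simp [*]
  · funext p
    refine ext_coord fun i j => ?_
    fin_cases i <;> fin_cases j <;> simp [Fin.sum_univ_succ] <;> ring

/-- Over two elements `x² = x`, hence `s²t = st² = st`. The two middle vectors of the cubic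
parametrization merge into one, and the three points form a conic. -/
lemma isNormalRationalCurve_two_solid11 (hF : Nat.card F = 2) :
    IsNormalRationalCurve 2 (section23 (solid11 F)) := by
  have : Finite F := Nat.finite_of_card_ne_zero (by simp [hF])
  have := Fintype.ofFinite F
  have hsq : ∀ x : F, x ^ 2 = x := fun x => by
    rw [← hF, Nat.card_eq_fintype_card, FiniteField.pow_card]
  rw [section23_solid11]
  refine isNormalRationalCurve_iff.2
    ⟨![E F 0 2, E F 1 2 - E F 0 1 + (E F 0 0 - E F 1 1), E F 1 0], ?_, congrArg paramSet ?_⟩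
  · refine linearIndependent_of_coord fun g hg => ?_
    have h0 := hg 0 2
    have h1 := hg 1 2
    have h3 := hg 1 0
    simp [Fin.sum_univ_succ] at h0 h1 h3
    intro k; fin_cases k <;> simp [*]
  · funext p
    refine ext_coord fun i j => ?_
    have h1 := hsq p.1
    have h2 := hsq p.2
    fin_cases i <;> fin_cases j <;> simp [Fin.sum_univ_succ, -mul_eq_mul_left_iff, -mul_eq_mul_right_iff]
    · linear_combination p.1 * h2
    · linear_combination p.2 * h1
    · linear_combination p.1 * h1
    · linear_combination p.2 * h2
    · linear_combination p.1 * h2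
    · linear_combination p.2 * h1

/-- The equation forces `(b 0, b 1)` to be a multiple `m` of `(a 1, -a 0)` and leaves `b 2 = l`
free. For fixed `a` this is the line joining a point linear in `a` to a point quadratic in `a`. -/
lemma isCubicScroll_hyp4 : IsCubicScroll (section23 (hyp4 F)) := by
  have hφ : ∀ p : F × F × F × F, p.2.2.1 • (p.1 • E F 0 2 + p.2.1 • E F 1 2) +
        p.2.2.2 • (p.1 ^ 2 • -E F 0 1 + (p.1 * p.2.1) • (E F 0 0 - E F 1 1)
          + p.2.1 ^ 2 • E F 1 0) =
      ![p.1, p.2.1] ⊗ₜ[F] ![p.2.2.2 * p.2.1, -(p.2.2.2 * p.1), p.2.2.1] := by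
    intro p
    refine ext_coord fun i j => ?_
    fin_cases i <;> fin_cases j <;> simp <;> ring
  refine isCubicScroll_iff.2 ⟨![E F 0 2, E F 1 2, -E F 0 1, E F 0 0 - E F 1 1, E F 1 0], ?_,
    Set.Subset.antisymm ?_ (paramSet_subset_section23 hφ fun p => ?_)⟩
  · refine linearIndependent_of_coord fun g hg => ?_
    have h0 := hg 0 2
    have h1 := hg 1 2
    have h2 := hg 0 1
    have h3 := hg 0 0
    have h4 := hg 1 0
    simp [Fin.sum_univ_succ] at h0 h1 h2 h3 h4
    intro k; fin_cases k <;> simp [*]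
  · intro P hP
    obtain ⟨a, -, b, -, hab, rfl⟩ := hP.2
    rw [mk_mem_section23, tmul_mem_hyp4] at hP
    by_cases h0 : a 0 = 0
    · have ha1 : a 1 ≠ 0 := (coord_ne_zero_or (left_ne_zero hab)).resolve_left (· h0)
      simp [h0, ha1] at hP
      refine mk_mem_paramSet hab (a 0, a 1, b 2, b 0 / a 1) 1 ((one_smul _ _).trans
        ((hφ _).trans (ext_coord fun i j => ?_)))
      fin_cases i <;> fin_cases j <;> simp [h0, hP]
      field_simp
      simp
    · have hb : b 0 = - (a 1 * b 1) / a 0 := by field_simp; linear_combination hP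
      refine mk_mem_paramSet hab (a 0, a 1, b 2, -b 1 / a 0) 1 ((one_smul _ _).trans
        ((hφ _).trans (ext_coord fun i j => ?_)))
      fin_cases i <;> fin_cases j <;> simp [hb] <;> field_simp <;> simp
  · refine (congrArg (· ∈ hyp4 F) (hφ p)).mpr (tmul_mem_hyp4.2 ?_)
    simp; ring

/-! ### Lines `PG(F² ⊗ v)` in the representatives -/

lemma containsLine21_solid6 : ContainsLine21 (solid6 F) :=
  ⟨![0, 0, 1], vec_ne_zero 2 (by simp), fun a => by simp [tmul_mem_solid6]⟩

lemma containsLine21_solid10 (u v : F) : ContainsLine21 (solid10 u v) :=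
  ⟨![0, 0, 1], vec_ne_zero 2 (by simp), fun a => by simp [tmul_mem_solid10]⟩

lemma not_containsLine21_solid7 : ¬ ContainsLine21 (solid7 F) := by
  rintro ⟨v, hv, h⟩
  have h0 := h ![1, 0]
  have h1 := h ![0, 1]
  simp [tmul_mem_solid7] at h0 h1
  exact hv (by ext i; fin_cases i <;> simp [*])

lemma not_containsLine21_solid11 : ¬ ContainsLine21 (solid11 F) := by
  rintro ⟨v, hv, h⟩
  have h0 := h ![1, 0]
  have h1 := h ![0, 1]
  simp [tmul_mem_solid11] at h0 h1
  exact hv (by ext i; fin_cases i <;> simp [*])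

end

end Tensor23

/-! ### Tools for the classification: bases, standard forms of lines, quadratics over finite fields.
-/

namespace Tensor23

section

variable {F : Type*} [Field F]

/-! ### Linear algebra of small families -/

lemma range_pair {W : Type*} (x y : W) : Set.range ![x, y] = {x, y} := by
  ext z; simp [eq_comm, or_comm]

section SmallFamilies

variable {W : Type*} [AddCommGroup W] [Module F W]

lemma span_pair_eq {A B A' B' : W} (a b c d : F) (hA : A' = a • A + b • B)
    (hB : B' = c • A + d • B) (hdet : a * d - b * c ≠ 0) :
    Submodule.span F {A', B'} = Submodule.span F {A, B} := by
  -- The inverse change of basis, with the determinant cleared.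
  have hA' : (a * d - b * c) • A = d • A' + (-b) • B' := by rw [hA, hB]; module
  have hB' : (a * d - b * c) • B = (-c) • A' + a • B' := by rw [hA, hB]; module
  apply le_antisymm <;> rw [Submodule.span_le] <;> rintro _ (rfl | rfl)
  · exact Submodule.mem_span_pair.2 ⟨a, b, hA.symm⟩
  · exact Submodule.mem_span_pair.2 ⟨c, d, hB.symm⟩
  · exact (Submodule.smul_mem_iff _ hdet).1 (Submodule.mem_span_pair.2 ⟨d, -b, hA'.symm⟩)
  · exact (Submodule.smul_mem_iff _ hdet).1 (Submodule.mem_span_pair.2 ⟨-c, a, hB'.symm⟩)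

lemma linearIndependent_pair_of_det {x y x' y' : W} (h : LinearIndependent F ![x, y]) (a b c d : F)
    (hx : x' = a • x + b • y) (hy : y' = c • x + d • y) (hdet : a * d - b * c ≠ 0) :
    LinearIndependent F ![x', y'] := by
  rw [LinearIndependent.pair_iff] at h ⊢
  intro s t hst
  obtain ⟨h1, h2⟩ := h (s * a + t * c) (s * b + t * d) (by
    rw [← hst, hx, hy]; module)
  constructor
  · refine (mul_eq_zero.1 ?_).resolve_left hdet
    linear_combination d * h1 - c * h2
  · refine (mul_eq_zero.1 ?_).resolve_left hdet
    linear_combination a * h2 - b * h1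

lemma linearIndependent_triple_cons {x y z : W} (h : LinearIndependent F ![y, z])
    (hx : x ∉ Submodule.span F {y, z}) : LinearIndependent F ![x, y, z] := by
  refine linearIndependent_finCons.2 ⟨h, ?_⟩
  rwa [range_pair]

lemma linearIndependent_triple_rotate {x y z : W} (h : LinearIndependent F ![x, y, z]) :
    LinearIndependent F ![y, z, x] := by
  have := h.comp ![1, 2, 0] (by decide)
  convert this using 1
  ext i; fin_cases i <;> rfl

lemma exists_linearIndependent_triple {y z : Fin 3 → F} (h : LinearIndependent F ![y, z]) :
    ∃ x, LinearIndependent F ![y, z, x] := by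
  obtain ⟨x, hx⟩ := exists_linearIndependent_cons_of_lt_finrank h (by simp)
  exact ⟨x, linearIndependent_triple_rotate hx⟩

lemma not_linearIndependent_pair {x y : W} (hx : x ≠ 0) (h : ¬ LinearIndependent F ![x, y]) :
    ∃ c : F, y = c • x := by
  rw [LinearIndependent.pair_iff' hx] at h
  push Not at h
  obtain ⟨c, hc⟩ := h
  exact ⟨c, hc.symm⟩

lemma exists_eq_span_pair {L : Submodule F W} (hL : Module.finrank F L = 2) {x : W} (hx : x ∈ L)
    (hx0 : x ≠ 0) : ∃ y, LinearIndependent F ![x, y] ∧ L = Submodule.span F {x, y} := by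
  obtain ⟨y, hy⟩ := exists_linearIndependent_pair_of_one_lt_finrank (R := F) (M := L) (by lia)
    (x := ⟨x, hx⟩) (fun h => hx0 (congrArg Subtype.val h))
  have hy' : LinearIndependent F ![x, (y : W)] := by
    rw [LinearIndependent.pair_iff] at hy ⊢
    exact fun s t hst => hy s t (Subtype.ext hst)
  have : Module.Finite F L := Module.finite_of_finrank_pos (by lia)
  refine ⟨y, hy', (Submodule.eq_of_le_of_finrank_le ?_ ?_).symm⟩
  · rw [Submodule.span_le]
    rintro _ (rfl | rfl)
    exacts [hx, y.2]
  · have := finrank_span_eq_card hy'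
    rw [range_pair, Fintype.card_fin] at this
    rw [this, hL]

lemma exists_eq_span_singleton {L : Submodule F W} (hL : Module.finrank F L = 1) :
    ∃ x, x ≠ 0 ∧ L = Submodule.span F {x} := by
  obtain ⟨x, hx, hx0⟩ := L.ne_bot_iff.1 (by rintro rfl; simp at hL)
  have : Module.Finite F L := Module.finite_of_finrank_pos (by lia)
  exact ⟨x, hx0, (Submodule.eq_of_le_of_finrank_le
    ((Submodule.span_singleton_le_iff_mem _ _).2 hx)
    (by rw [hL, finrank_span_singleton hx0])).symm⟩

lemma exists_equiv_stdVec {n : ℕ} {v : Fin n → Fin n → F} (hv : LinearIndependent F v) :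
    ∃ g : (Fin n → F) ≃ₗ[F] (Fin n → F), ∀ i, g (stdVec F i) = v i := by
  let b := basisOfLinearIndependentOfCardEqFinrank' v hv (by simp)
  refine ⟨(Pi.basisFun F (Fin n)).equiv b (Equiv.refl _), fun i => ?_⟩
  have := (Pi.basisFun F (Fin n)).equiv_apply i b (Equiv.refl _)
  rw [Pi.basisFun_apply] at this
  rw [this]
  simp [b]

end SmallFamilies

/-! ### Standard forms of lines -/

/-- Each representative is a pattern in the tensors `E F i j`. A subspace lies in its orbit as soon
as it shows the same pattern in some `f i ⊗ k j`, so the classification amounts to finding adapted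
bases. -/
lemma exists_congr_E {f : Fin 2 → Fin 2 → F} {k : Fin 3 → Fin 3 → F} (hf : LinearIndependent F f)
    (hk : LinearIndependent F k) :
    ∃ (g : (Fin 2 → F) ≃ₗ[F] (Fin 2 → F)) (h : (Fin 3 → F) ≃ₗ[F] (Fin 3 → F)),
      ∀ i j, TensorProduct.congr g h (E F i j) = f i ⊗ₜ[F] k j := by
  obtain ⟨g, hg⟩ := exists_equiv_stdVec hf
  obtain ⟨h, hh⟩ := exists_equiv_stdVec hk
  exact ⟨g, h, fun i j => by rw [E, TensorProduct.congr_tmul, hg, hh]⟩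

lemma map_span_pair (f : V F ≃ₗ[F] V F) (A B : V F) :
    (Submodule.span F {A, B}).map f.toLinearMap = Submodule.span F {f A, f B} := by
  rw [Submodule.map_span, Set.image_pair]; rfl

variable {f₀ f₁ : Fin 2 → F} {k₀ k₁ k₂ : Fin 3 → F}

lemma span_mem_orb_line2 (hf : LinearIndependent F ![f₀, f₁])
    (hk : LinearIndependent F ![k₀, k₁, k₂]) :
    Submodule.span F {f₀ ⊗ₜ[F] k₀, f₀ ⊗ₜ[F] k₁} ∈ orb (line2 F) := by
  obtain ⟨g, h, hgh⟩ := exists_congr_E hf hk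
  refine mem_orb.2 ⟨g, h, ?_⟩
  rw [line2_eq, map_span_pair, hgh, hgh]; rfl

lemma span_mem_orb_line4T (hf : LinearIndependent F ![f₀, f₁])
    (hk : LinearIndependent F ![k₀, k₁, k₂]) :
    Submodule.span F {f₀ ⊗ₜ[F] k₀, f₁ ⊗ₜ[F] k₀} ∈ orb (line4T F) := by
  obtain ⟨g, h, hgh⟩ := exists_congr_E hf hk
  refine mem_orb.2 ⟨g, h, ?_⟩
  rw [line4T_eq, map_span_pair, hgh, hgh]; rfl

lemma span_mem_orb_line5 (hf : LinearIndependent F ![f₀, f₁])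
    (hk : LinearIndependent F ![k₀, k₁, k₂]) :
    Submodule.span F {f₀ ⊗ₜ[F] k₀, f₁ ⊗ₜ[F] k₁} ∈ orb (line5 F) := by
  obtain ⟨g, h, hgh⟩ := exists_congr_E hf hk
  refine mem_orb.2 ⟨g, h, ?_⟩
  rw [line5_eq, map_span_pair, hgh, hgh]; rfl

lemma span_mem_orb_line6 (hf : LinearIndependent F ![f₀, f₁])
    (hk : LinearIndependent F ![k₀, k₁, k₂]) :
    Submodule.span F {f₀ ⊗ₜ[F] k₀ + f₁ ⊗ₜ[F] k₁, f₁ ⊗ₜ[F] k₀} ∈ orb (line6 F) := by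
  obtain ⟨g, h, hgh⟩ := exists_congr_E hf hk
  refine mem_orb.2 ⟨g, h, ?_⟩
  rw [line6_eq, map_span_pair, map_add, hgh, hgh, hgh]; rfl

lemma span_mem_orb_line7 (hf : LinearIndependent F ![f₀, f₁])
    (hk : LinearIndependent F ![k₀, k₁, k₂]) :
    Submodule.span F {f₀ ⊗ₜ[F] k₀ + f₁ ⊗ₜ[F] k₂, f₀ ⊗ₜ[F] k₁} ∈ orb (line7 F) := by
  obtain ⟨g, h, hgh⟩ := exists_congr_E hf hk
  refine mem_orb.2 ⟨g, h, ?_⟩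
  rw [line7_eq, map_span_pair, map_add, hgh, hgh, hgh]; rfl

lemma span_mem_orb_line10 (hf : LinearIndependent F ![f₀, f₁])
    (hk : LinearIndependent F ![k₀, k₁, k₂]) (u v : F) :
    Submodule.span F {f₀ ⊗ₜ[F] k₀ + u • f₀ ⊗ₜ[F] k₁ + f₁ ⊗ₜ[F] k₁,
      f₀ ⊗ₜ[F] k₁ + v • f₁ ⊗ₜ[F] k₀} ∈ orb (line10 u v) := by
  obtain ⟨g, h, hgh⟩ := exists_congr_E hf hk
  refine mem_orb.2 ⟨g, h, ?_⟩
  simp only [line10_eq, map_span_pair, map_add, map_smul, hgh]; rfl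

lemma span_mem_orb_line11 (hf : LinearIndependent F ![f₀, f₁])
    (hk : LinearIndependent F ![k₀, k₁, k₂]) :
    Submodule.span F {f₀ ⊗ₜ[F] k₀ + f₁ ⊗ₜ[F] k₁, f₀ ⊗ₜ[F] k₁ + f₁ ⊗ₜ[F] k₂} ∈ orb (line11 F) := by
  obtain ⟨g, h, hgh⟩ := exists_congr_E hf hk
  refine mem_orb.2 ⟨g, h, ?_⟩
  simp only [line11_eq, map_span_pair, map_add, hgh]; rfl

lemma span_mem_orb_pt1 (hf : LinearIndependent F ![f₀, f₁])
    (hk : LinearIndependent F ![k₀, k₁, k₂]) :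
    Submodule.span F {f₀ ⊗ₜ[F] k₀} ∈ orb (pt1 F) := by
  obtain ⟨g, h, hgh⟩ := exists_congr_E hf hk
  refine mem_orb.2 ⟨g, h, ?_⟩
  rw [pt1_eq, Submodule.map_span, Set.image_singleton]
  exact congrArg (fun x => Submodule.span F {x}) (hgh 0 0).symm

lemma span_mem_orb_pt4 (hf : LinearIndependent F ![f₀, f₁])
    (hk : LinearIndependent F ![k₀, k₁, k₂]) :
    Submodule.span F {f₀ ⊗ₜ[F] k₀ + f₁ ⊗ₜ[F] k₁} ∈ orb (pt4 F) := by
  obtain ⟨g, h, hgh⟩ := exists_congr_E hf hk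
  refine mem_orb.2 ⟨g, h, ?_⟩
  rw [pt4_eq, Submodule.map_span, Set.image_singleton]
  refine congrArg (fun x => Submodule.span F {x}) ?_
  refine Eq.symm ((map_add _ _ _).trans ?_)
  exact congrArg₂ _ (hgh 0 0) (hgh 1 1)

/-! ### Quadratic polynomials over a finite field -/

/-- If `x² - t x + n` and `x² - t' x + n'` are irreducible over a finite field, then the root field
of the first contains an element `α + β r` with trace `t'` and norm `n'`. -/
lemma exists_trace_norm_eq [Finite F] {t n t' n' : F} (h : ∀ x, x ^ 2 - t * x + n ≠ 0)
    (h' : ∀ x, x ^ 2 - t' * x + n' ≠ 0) :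
    ∃ a b : F, b ≠ 0 ∧ 2 * a + b * t = t' ∧ a ^ 2 + a * b * t + b ^ 2 * n = n' := by
  open Polynomial in
  have key : ∀ t n : F, (∀ x, x ^ 2 - t * x + n ≠ 0) →
      (X ^ 2 - C t * X + C n : F[X]).Monic ∧ (X ^ 2 - C t * X + C n : F[X]).natDegree = 2 ∧
        Irreducible (X ^ 2 - C t * X + C n : F[X]) := by
    intro t n h
    have hd : (X ^ 2 - C t * X + C n : F[X]).natDegree = 2 := by compute_degree!
    have hm : (X ^ 2 - C t * X + C n : F[X]).Monic := by monicity!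
    refine ⟨hm, hd, (hm.irreducible_iff_roots_eq_zero_of_degree_le_three (by lia) (by lia)).2 ?_⟩
    refine Multiset.eq_zero_of_forall_notMem fun x hx => h x ?_
    simpa using (Polynomial.mem_roots'.1 hx).2
  obtain ⟨hm, hd, hi⟩ := key t n h
  obtain ⟨hm', hd', hi'⟩ := key t' n' h'
  open Polynomial in
  set p : F[X] := X ^ 2 - C t * X + C n with hp
  open Polynomial in
  set p' : F[X] := X ^ 2 - C t' * X + C n' with hp'
  have : Fact (Irreducible p) := ⟨hi⟩
  have : Fact (Irreducible p') := ⟨hi'⟩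
  have hfr : Module.finrank F (AdjoinRoot p) = 2 := by
    rw [(AdjoinRoot.powerBasis hm.ne_zero).finrank, AdjoinRoot.powerBasis_dim, hd]
  have hfr' : Module.finrank F (AdjoinRoot p') = 2 := by
    rw [(AdjoinRoot.powerBasis hm'.ne_zero).finrank, AdjoinRoot.powerBasis_dim, hd']
  have : Module.Finite F (AdjoinRoot p) := Module.finite_of_finrank_pos (by lia)
  have : Finite (AdjoinRoot p) := Module.finite_of_finite F
  -- Finiteness enters here: the root field of `p'` embeds in that of `p` because the degrees agree.
  -- The required element is the image of the root of `p'`.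
  obtain ⟨φ⟩ := FiniteField.nonempty_algHom_of_finrank_dvd (F := F) (K := AdjoinRoot p')
    (L := AdjoinRoot p) (by rw [hfr, hfr'])
  have hr : AdjoinRoot.root p ^ 2 - algebraMap F _ t * AdjoinRoot.root p + algebraMap F _ n = 0 := by
    have := AdjoinRoot.eval₂_root p
    simpa [hp] using this
  have hr' : φ (AdjoinRoot.root p') ^ 2 - algebraMap F _ t' * φ (AdjoinRoot.root p') +
      algebraMap F _ n' = 0 := by
    have := AdjoinRoot.eval₂_root p'
    have h2 : AdjoinRoot.root p' ^ 2 - algebraMap F _ t' * AdjoinRoot.root p' +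
      algebraMap F _ n' = 0 := by simpa [hp'] using this
    have h3 := congrArg φ h2
    simpa only [map_add, map_sub, map_mul, map_pow, AlgHom.commutes, map_zero] using h3
  obtain ⟨a, b, hab⟩ : ∃ a b : F, φ (AdjoinRoot.root p') =
      algebraMap F _ a + algebraMap F _ b * AdjoinRoot.root p := by
    obtain ⟨f, hf⟩ := AdjoinRoot.mk_surjective (φ (AdjoinRoot.root p'))
    have hdeg : (f %ₘ p).natDegree ≤ 1 := by
      have := Polynomial.natDegree_modByMonic_lt f hm (fun h1 => by rw [h1] at hd; simp at hd)
      lia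
    obtain ⟨b, a, hba⟩ := Polynomial.exists_eq_X_add_C_of_natDegree_le_one hdeg
    refine ⟨a, b, ?_⟩
    rw [← hf, ← AdjoinRoot.mk_leftInverse hm (AdjoinRoot.mk p f), AdjoinRoot.modByMonicHom_mk, hba]
    simp [add_comm]
  -- A nontrivial relation between `1` and the root would put the root in `F`, contradicting `h`.
  have hindep : ∀ c d : F, algebraMap F _ c + algebraMap F _ d * AdjoinRoot.root p = 0 →
      c = 0 ∧ d = 0 := by
    intro c d hcd
    have hd0 : d = 0 := by
      by_contra hd0
      refine h (-c / d) ((algebraMap F (AdjoinRoot p)).injective ?_)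
      have hroot : AdjoinRoot.root p = algebraMap F (AdjoinRoot p) (-c / d) := by
        have : algebraMap F (AdjoinRoot p) d ≠ 0 := by simpa using hd0
        rw [map_div₀, map_neg, eq_div_iff this]
        linear_combination hcd
      rw [hroot] at hr
      simpa using hr
    subst hd0
    simpa using hcd
  -- For `b = 0` the image of the root of `p'` would be the element `a` of `F`.
  have hb : b ≠ 0 := by
    rintro rfl
    refine h' a ((algebraMap F (AdjoinRoot p)).injective ?_)
    rw [hab] at hr'
    simpa using hr'
  -- Insert `a + b r` into `x² - t' x + n'`, reduce by `r² = t r - n`, and compare coefficients of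
  -- `1` and `r`. Cancelling `b` in the second gives the trace; the first then gives the norm.
  obtain ⟨h1, h2⟩ := hindep (a ^ 2 - b ^ 2 * n - t' * a + n') (2 * a * b + b ^ 2 * t - t' * b) (by
    rw [hab] at hr'
    simp only [map_add, map_sub, map_mul, map_pow, map_ofNat]
    linear_combination hr' - (algebraMap F _ b) ^ 2 * hr)
  have h3 : 2 * a + b * t = t' := mul_left_cancel₀ hb (by linear_combination h2)
  exact ⟨a, b, hb, h3, by linear_combination -h1 + a * h3⟩

/-- Admissible parameters exist. -/
lemma exists_admissible [Finite F] : ∃ u v : F, Admissible u v := by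
  -- `x² + x` vanishes at both `0` and `-1`, so on a finite field it is not injective and misses
  -- some `c`. This works in every characteristic.
  have hns : ¬ Function.Surjective fun x : F => x ^ 2 + x := by
    intro hs
    have := Finite.injective_iff_surjective.2 hs (a₁ := 0) (a₂ := -1) (by simp)
    simp at this
  simp only [Function.Surjective] at hns
  push Not at hns
  obtain ⟨c, hc⟩ := hns
  have hc0 : c ≠ 0 := fun h => hc 0 (by simp [h])
  -- The polynomial becomes `c l² - l - 1`, and a root `l` would give `c = l⁻² + l⁻¹`.
  refine ⟨-1 / c, c, hc0, fun l hl => ?_⟩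
  have hl' : c * l ^ 2 - l - 1 = 0 := by
    rw [div_mul_cancel₀ _ hc0] at hl; linear_combination hl
  have hl0 : l ≠ 0 := by rintro rfl; simp at hl'
  refine hc l⁻¹ ?_
  field_simp
  linear_combination -hl'

end

end Tensor23

namespace Tensor23

section

variable {F : Type*} [Field F]

/-! ### Classification of points and lines -/

/-- `L` lies in one of the seven orbits of lines. -/
def IsClassified (u v : F) (L : Submodule F (V F)) : Prop :=
  L ∈ orb (line2 F) ∨ L ∈ orb (line4T F) ∨ L ∈ orb (line5 F) ∨ L ∈ orb (line6 F) ∨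
    L ∈ orb (line7 F) ∨ L ∈ orb (line10 u v) ∨ L ∈ orb (line11 F)

lemma exists_eq_add_tmul {f₀ f₁ : Fin 2 → F} (hf : LinearIndependent F ![f₀, f₁]) (x : V F) :
    ∃ r s : Fin 3 → F, x = f₀ ⊗ₜ[F] r + f₁ ⊗ₜ[F] s := by
  obtain ⟨g, hg⟩ := exists_equiv_stdVec hf
  obtain ⟨r, s, hrs⟩ := eq_add_tmul
    ((TensorProduct.congr g (LinearEquiv.refl F (Fin 3 → F))).symm x)
  refine ⟨r, s, ?_⟩
  rw [LinearEquiv.symm_apply_eq] at hrs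
  rw [hrs, map_add, TensorProduct.congr_tmul, TensorProduct.congr_tmul, hg, hg]
  rfl

lemma exists_linearIndependent_left {a : Fin 2 → F} (ha : a ≠ 0) :
    ∃ a', LinearIndependent F ![a, a'] :=
  exists_linearIndependent_pair_of_one_lt_finrank (by simp) ha

lemma exists_linearIndependent_right {p : Fin 3 → F} (hp : p ≠ 0) :
    ∃ p', LinearIndependent F ![p, p'] :=
  exists_linearIndependent_pair_of_one_lt_finrank (by simp) hp

/-- A line through a point of rank one. -/
lemma isClassified_of_tmul_mem (u v : F) {L : Submodule F (V F)} (hL : Module.finrank F L = 2)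
    {a : Fin 2 → F} {p : Fin 3 → F} (h0 : a ⊗ₜ[F] p ≠ 0) (hap : a ⊗ₜ[F] p ∈ L) :
    IsClassified u v L := by
  have hp0 : p ≠ 0 := right_ne_zero h0
  obtain ⟨N, hN, rfl⟩ := exists_eq_span_pair hL hap h0
  obtain ⟨a', hf⟩ := exists_linearIndependent_left (left_ne_zero h0)
  obtain ⟨r, s, rfl⟩ := exists_eq_add_tmul hf N
  -- The second generator is `a ⊗ r + a' ⊗ s`. If `p`, `s` are independent, `o₅` or `o₇` arises
  -- according to whether `r` lies in their span. If `s = γ p`, an `r` independent of `p` gives `o₂`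
  -- for `γ = 0` and `o₆` otherwise, and `r` proportional to `p` gives `o₄ᵀ`.
  by_cases hps : LinearIndependent F ![p, s]
  · by_cases hr : r ∈ Submodule.span F {p, s}
    · obtain ⟨α, β, rfl⟩ := Submodule.mem_span_pair.1 hr
      obtain ⟨k, hk⟩ := exists_linearIndependent_triple hps
      have hf' : LinearIndependent F ![a, β • a + a'] :=
        linearIndependent_pair_of_det hf 1 0 β 1 (by simp) (by simp) (by simp)
      refine Or.inr (Or.inr (Or.inl ?_))
      -- Subtracting `α` times `a ⊗ p` from the second generator leaves the pure tensor `(β • a +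
      -- a') ⊗ s`.
      rw [span_pair_eq (A := a ⊗ₜ[F] p) (B := (β • a + a') ⊗ₜ[F] s) 1 0 α 1 (by simp) ?_ (by simp)]
      · exact span_mem_orb_line5 hf' hk
      · simp only [TensorProduct.tmul_add, TensorProduct.add_tmul, TensorProduct.tmul_smul,
          ← TensorProduct.smul_tmul']
        module
    · have hk := linearIndependent_triple_cons hps hr
      refine Or.inr (Or.inr (Or.inr (Or.inr (Or.inl ?_))))
      rw [Set.pair_comm]
      exact span_mem_orb_line7 hf hk
  · obtain ⟨γ, rfl⟩ := not_linearIndependent_pair hp0 hps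
    by_cases hpr : LinearIndependent F ![p, r]
    · obtain ⟨k, hk⟩ := exists_linearIndependent_triple hpr
      by_cases hγ : γ = 0
      · subst hγ
        left
        simpa using span_mem_orb_line2 hf hk
      · have hf' : LinearIndependent F ![γ • a', a] :=
          linearIndependent_pair_of_det hf 0 γ 1 0 (by simp) (by simp) (by simpa using hγ)
        refine Or.inr (Or.inr (Or.inr (Or.inl ?_)))
        rw [Set.pair_comm, TensorProduct.tmul_smul, TensorProduct.smul_tmul', add_comm]
        exact span_mem_orb_line6 hf' hk
    · obtain ⟨δ, rfl⟩ := not_linearIndependent_pair hp0 hpr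
      obtain ⟨p', hp'⟩ := exists_linearIndependent_right hp0
      obtain ⟨k, hk⟩ := exists_linearIndependent_triple hp'
      have hγ : γ ≠ 0 := by
        rintro rfl
        have := (LinearIndependent.pair_iff.1 hN) δ (-1) (by simp)
        simp at this
      have hf' : LinearIndependent F ![a, δ • a + γ • a'] :=
        linearIndependent_pair_of_det hf 1 0 δ γ (by simp) (by simp) (by simpa using hγ)
      refine Or.inr (Or.inl ?_)
      rw [TensorProduct.tmul_smul, TensorProduct.tmul_smul, TensorProduct.smul_tmul',
        TensorProduct.smul_tmul', ← TensorProduct.add_tmul]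
      exact span_mem_orb_line4T hf' hk

/-- If a subspace contains no tensor of rank one, then the rows of its nonzero members are
linearly independent. -/
lemma linearIndependent_rows {L : Submodule F (V F)} (hL : ∀ a p, a ⊗ₜ[F] p ∈ L → a ⊗ₜ[F] p = 0)
    {f₀ f₁ : Fin 2 → F} {r s : Fin 3 → F} (hx : f₀ ⊗ₜ[F] r + f₁ ⊗ₜ[F] s ∈ L)
    (hx0 : f₀ ⊗ₜ[F] r + f₁ ⊗ₜ[F] s ≠ 0) : LinearIndependent F ![r, s] := by
  by_contra h
  by_cases hr : r = 0
  · subst hr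
    simp only [TensorProduct.tmul_zero, zero_add] at hx hx0
    exact hx0 (hL _ _ hx)
  · obtain ⟨c, rfl⟩ := not_linearIndependent_pair hr h
    rw [TensorProduct.tmul_smul, TensorProduct.smul_tmul', ← TensorProduct.add_tmul] at hx hx0
    exact hx0 (hL _ _ hx)

/-- Contraction of the second factor of a tensor with a functional. -/
noncomputable def contractRight (χ : (Fin 3 → F) →ₗ[F] F) : V F →ₗ[F] (Fin 2 → F) :=
  TensorProduct.lift ((LinearMap.lsmul F (Fin 2 → F)).flip.compl₂ χ)

lemma contractRight_tmul (χ : (Fin 3 → F) →ₗ[F] F) (a : Fin 2 → F) (b : Fin 3 → F) :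
    contractRight χ (a ⊗ₜ[F] b) = χ b • a := rfl

lemma sub_smul_mem_span_pair (M N : V F) (c : F) : N - c • M ∈ Submodule.span F {M, N} :=
  Submodule.mem_span_pair.2 ⟨-c, 1, by module⟩

/-- A line without points of rank one that is contained in the span of an `S_{2,2}`. -/
lemma mem_orb_line10 [Finite F] {u v : F} (huv : Admissible u v) {r s : Fin 3 → F} {a b c d : F}
    (hM : LinearIndependent F ![r, s])
    (hL : ∀ x p, x ⊗ₜ[F] p ∈ Submodule.span F
      {stdVec F (0 : Fin 2) ⊗ₜ[F] r + stdVec F 1 ⊗ₜ[F] s,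
        stdVec F (0 : Fin 2) ⊗ₜ[F] (a • r + b • s) + stdVec F 1 ⊗ₜ[F] (c • r + d • s)} →
      x ⊗ₜ[F] p = 0)
    (hMN : LinearIndependent F ![stdVec F (0 : Fin 2) ⊗ₜ[F] r + stdVec F 1 ⊗ₜ[F] s,
      stdVec F (0 : Fin 2) ⊗ₜ[F] (a • r + b • s) + stdVec F 1 ⊗ₜ[F] (c • r + d • s)]) :
    Submodule.span F {stdVec F (0 : Fin 2) ⊗ₜ[F] r + stdVec F 1 ⊗ₜ[F] s,
        stdVec F (0 : Fin 2) ⊗ₜ[F] (a • r + b • s) + stdVec F 1 ⊗ₜ[F] (c • r + d • s)} ∈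
      orb (line10 u v) := by
  generalize he₀ : stdVec F (0 : Fin 2) = e₀ at *
  generalize he₁ : stdVec F (1 : Fin 2) = e₁ at *
  have he : LinearIndependent F ![e₀, e₁] := by
    rw [LinearIndependent.pair_iff]
    intro x y hxy
    have h0 := congrFun hxy 0
    have h1 := congrFun hxy 1
    simpa [← he₀, ← he₁] using And.intro h0 h1
  -- the rows of every member of the pencil are independent
  have hrows : ∀ x : F, LinearIndependent F ![(a - x) • r + b • s, c • r + (d - x) • s] := by
    intro x
    have hx : e₀ ⊗ₜ[F] ((a - x) • r + b • s) + e₁ ⊗ₜ[F] (c • r + (d - x) • s) =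
        (e₀ ⊗ₜ[F] (a • r + b • s) + e₁ ⊗ₜ[F] (c • r + d • s)) -
          x • (e₀ ⊗ₜ[F] r + e₁ ⊗ₜ[F] s) := by
      simp only [TensorProduct.tmul_add, TensorProduct.tmul_smul]
      module
    refine linearIndependent_rows (f₀ := e₀) (f₁ := e₁) hL ?_ ?_
    · rw [hx]
      exact sub_smul_mem_span_pair _ _ _
    · rw [hx]
      intro h0
      have := (LinearIndependent.pair_iff.1 hMN) (-x) 1 (by rw [← h0]; module)
      exact one_ne_zero this.2
  -- If `c = 0`, then `d` is an eigenvalue and the second row of that pencil member vanishes.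
  have hc : c ≠ 0 := by
    rintro rfl
    have := (LinearIndependent.pair_iff.1 (hrows d)) 0 1 (by simp)
    exact one_ne_zero this.2
  -- This is the characteristic polynomial of the matrix with rows `(a, b)` and `(c, d)`. At a root,
  -- the coefficients `-c` and `a - x` give a relation between the rows.
  have hroot : ∀ x : F, x ^ 2 - (a + d) * x + (a * d - b * c) ≠ 0 := by
    intro x hx
    have := (LinearIndependent.pair_iff.1 (hrows x)) (-c) (a - x) (by
      match_scalars
      · ring
      · linear_combination hx)
    exact hc (neg_eq_zero.1 this.1)
  -- For the representative of `o₁₀`, the second generator times the inverse of the first, as `2 ×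
  -- 2` matrices, has trace `-u v` and determinant `-v`. Admissibility says that its characteristic
  -- polynomial has no root.
  have hroot' : ∀ x : F, x ^ 2 - (-(u * v)) * x + (-v) ≠ 0 := by
    intro x hx
    have := (huv.eq_zero (b := x) (c := -1) (by linear_combination -hx)).2
    simp at this
  obtain ⟨α, β, hβ, htr, hdet⟩ := exists_trace_norm_eq hroot hroot'
  -- replace the second generator by one with the prescribed trace and determinant
  have hc' : β * c ≠ 0 := mul_ne_zero hβ hc
  obtain ⟨A, hA⟩ : ∃ A, A = α + β * a := ⟨_, rfl⟩
  obtain ⟨B, hB⟩ : ∃ B, B = β * b := ⟨_, rfl⟩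
  obtain ⟨C, hC⟩ : ∃ C, C = β * c := ⟨_, rfl⟩
  obtain ⟨D, hD⟩ : ∃ D, D = α + β * d := ⟨_, rfl⟩
  have hC0 : C ≠ 0 := hC ▸ hc'
  have htr' : u * v = -(A + D) := by rw [hA, hD]; linear_combination htr
  have hdet' : v = B * C - A * D := by rw [hA, hB, hC, hD]; linear_combination hdet
  have hspan : Submodule.span F {e₀ ⊗ₜ[F] r + e₁ ⊗ₜ[F] s,
      e₀ ⊗ₜ[F] (A • r + B • s) + e₁ ⊗ₜ[F] (C • r + D • s)} =
      Submodule.span F {e₀ ⊗ₜ[F] r + e₁ ⊗ₜ[F] s,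
        e₀ ⊗ₜ[F] (a • r + b • s) + e₁ ⊗ₜ[F] (c • r + d • s)} := by
    refine span_pair_eq 1 0 α β (by simp) ?_ (by simpa using hβ)
    simp only [TensorProduct.tmul_add, TensorProduct.tmul_smul, hA, hB, hC, hD]
    module
  rw [← hspan]
  -- The second rows `s` and `C • r + D • s` of the two generators form a cyclic basis, since `C ≠
  -- 0`. With `k₁ = C • r + D • s` and `k₀ + u • k₁ = s`, the vectors `f₀`, `f₁` are forced by
  -- writing the first generator as `f₀ ⊗ s + f₁ ⊗ k₁`.
  have hf : LinearIndependent F ![e₁ - (D / C) • e₀, C⁻¹ • e₀] :=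
    linearIndependent_pair_of_det he (-(D / C)) 1 C⁻¹ 0 (by module) (by module)
      (by simpa using hC0)
  have hk : LinearIndependent F ![s - u • (C • r + D • s), C • r + D • s] :=
    linearIndependent_pair_of_det hM (-(u * C)) (1 - u * D) C D (by module) rfl
      (by ring_nf; simpa using hC0)
  obtain ⟨k, hk⟩ := exists_linearIndependent_triple hk
  convert span_mem_orb_line10 hf hk u v using 3
  · simp only [TensorProduct.tmul_add, TensorProduct.tmul_sub, TensorProduct.sub_tmul,
      TensorProduct.tmul_smul, ← TensorProduct.smul_tmul']
    match_scalars <;> field_simp <;> ring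
  · simp only [TensorProduct.tmul_add, TensorProduct.tmul_sub, TensorProduct.sub_tmul,
      TensorProduct.tmul_smul, ← TensorProduct.smul_tmul']
    congr 1
    match_scalars
    · field_simp
      linear_combination htr'
    · field_simp
      linear_combination D * htr' - hdet'
    · ring
    · ring

/-- A line without points of rank one that is not contained in the span of an `S_{2,2}`. -/
lemma mem_orb_line11 {M N : V F} (hMN : LinearIndependent F ![M, N])
    (hL : ∀ x p, x ⊗ₜ[F] p ∈ Submodule.span F {M, N} → x ⊗ₜ[F] p = 0)
    (χ : (Fin 3 → F) →ₗ[F] F) (hχM : contractRight χ M = 0) (hχN : contractRight χ N ≠ 0) :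
    Submodule.span F {M, N} ∈ orb (line11 F) := by
  obtain ⟨b, hb⟩ : ∃ b, b = contractRight χ N := ⟨_, rfl⟩
  rw [← hb] at hχN
  obtain ⟨f, hf⟩ := exists_linearIndependent_left hχN
  obtain ⟨m', m, rfl⟩ := exists_eq_add_tmul hf M
  obtain ⟨n', n, rfl⟩ := exists_eq_add_tmul hf N
  simp only [map_add, contractRight_tmul] at hb hχM
  obtain ⟨hm', hm⟩ := (LinearIndependent.pair_iff.1 hf) _ _ hχM
  obtain ⟨hn', hn⟩ := (LinearIndependent.pair_iff.1 hf) (χ n' - 1) (χ n) (by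
    rw [sub_smul, one_smul, sub_add_eq_add_sub, ← hb, sub_self])
  -- A relation between `m` and `n` would make a combination of `M` and `N` a pure tensor with first
  -- factor `b`, hence zero.
  have hmn : LinearIndependent F ![m, n] := by
    rw [LinearIndependent.pair_iff]
    intro x y hxy
    have key : x • (b ⊗ₜ[F] m' + f ⊗ₜ[F] m) + y • (b ⊗ₜ[F] n' + f ⊗ₜ[F] n) =
        b ⊗ₜ[F] (x • m' + y • n') := by
      have h0 : b ⊗ₜ[F] (x • m' + y • n') =
          b ⊗ₜ[F] (x • m' + y • n') + f ⊗ₜ[F] (x • m + y • n) := by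
        rw [hxy, TensorProduct.tmul_zero, add_zero]
      rw [h0]
      simp only [TensorProduct.tmul_add, TensorProduct.tmul_smul]
      module
    refine (LinearIndependent.pair_iff.1 hMN) x y ?_
    rw [key]
    exact hL _ _ (key ▸ Submodule.mem_span_pair.2 ⟨x, y, rfl⟩)
  have htriple : ∀ k, χ k ≠ 0 → LinearIndependent F ![k, m, n] := by
    refine fun k hk => linearIndependent_triple_cons hmn fun hmem => hk ?_
    obtain ⟨x, y, rfl⟩ := Submodule.mem_span_pair.1 hmem
    simp [hm, hn]
  have hχn' : χ n' = 1 := sub_eq_zero.1 hn'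
  -- In the basis `n', m, n` the functional `χ` reads off the coefficient of `n'`, and `χ m' = 0`.
  obtain ⟨α, β, hαβ⟩ : ∃ α β : F, m' = α • m + β • n := by
    obtain ⟨B, hB'⟩ : ∃ B : Module.Basis (Fin 3) F (Fin 3 → F), ⇑B = ![n', m, n] :=
      ⟨basisOfLinearIndependentOfCardEqFinrank' _ (htriple n' (by simp [hχn'])) (by simp),
        coe_basisOfLinearIndependentOfCardEqFinrank' _ _ _⟩
    have hB := B.sum_repr m'
    simp only [hB', Fin.sum_univ_three] at hB
    have h0 := congrArg χ hB
    simp [hm, hn, hm', hχn'] at h0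
    refine ⟨B.repr m' 1, B.repr m' 2, hB.symm.trans ?_⟩
    rw [h0, zero_smul, zero_add]
    rfl
  have hβ : β ≠ 0 := by
    rintro rfl
    have key : b ⊗ₜ[F] m' + f ⊗ₜ[F] m = (α • b + f) ⊗ₜ[F] m := by
      rw [hαβ, zero_smul, add_zero, TensorProduct.tmul_smul, TensorProduct.add_tmul,
        TensorProduct.smul_tmul']
    refine hMN.ne_zero 0 (hL (α • b + f) m ?_ ▸ key)
    rw [← key]
    exact Submodule.subset_span (by simp)
  -- Now `M = (α • b + f) ⊗ m + (β • b) ⊗ n`. Keeping the same first factors, `N = (α • b + f) ⊗ n +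
  -- (β • b) ⊗ k` forces `k = β⁻¹ • (n' - α • n)`.
  have hf' : LinearIndependent F ![α • b + f, β • b] :=
    linearIndependent_pair_of_det hf α 1 β 0 (by module) (by module) (by simpa using hβ)
  have hk := htriple (β⁻¹ • (n' - α • n)) (by simp [hn, hχn', hβ])
  convert span_mem_orb_line11 hf' (linearIndependent_triple_rotate hk) using 3
  · rw [hαβ]
    simp only [TensorProduct.tmul_add, TensorProduct.add_tmul, TensorProduct.tmul_smul,
      ← TensorProduct.smul_tmul']
    module
  · simp only [TensorProduct.tmul_sub, TensorProduct.add_tmul, TensorProduct.tmul_smul,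
      ← TensorProduct.smul_tmul', smul_sub]
    congr 1
    match_scalars <;> field_simp
    ring

/-- The classification of lines. -/
lemma isClassified_of_finrank [Finite F] {u v : F} (huv : Admissible u v) {L : Submodule F (V F)}
    (hL : Module.finrank F L = 2) : IsClassified u v L := by
  by_cases hpure : ∃ a p, a ⊗ₜ[F] p ∈ L ∧ a ⊗ₜ[F] p ≠ 0
  · obtain ⟨a, p, hap, h0⟩ := hpure
    exact isClassified_of_tmul_mem u v hL h0 hap
  push Not at hpure
  obtain ⟨M, hM, hM0⟩ := L.ne_bot_iff.1 (by rintro rfl; simp at hL)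
  obtain ⟨N, hMN, rfl⟩ := exists_eq_span_pair hL hM hM0
  obtain ⟨r, s, rfl⟩ := eq_add_tmul M
  obtain ⟨r', s', rfl⟩ := eq_add_tmul N
  have hrs := linearIndependent_rows hpure hM hM0
  by_cases hin : r' ∈ Submodule.span F {r, s} ∧ s' ∈ Submodule.span F {r, s}
  · obtain ⟨a, b, rfl⟩ := Submodule.mem_span_pair.1 hin.1
    obtain ⟨c, d, rfl⟩ := Submodule.mem_span_pair.1 hin.2
    exact Or.inr (Or.inr (Or.inr (Or.inr (Or.inr (Or.inl (mem_orb_line10 huv hrs hpure hMN))))))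
  · obtain ⟨χ, hχ, hχ'⟩ : ∃ χ : (Fin 3 → F) →ₗ[F] F, Submodule.span F {r, s} ≤ LinearMap.ker χ ∧
        (χ r' ≠ 0 ∨ χ s' ≠ 0) := by
      by_cases hr' : r' ∈ Submodule.span F {r, s}
      · obtain ⟨χ, h1, h2⟩ := Submodule.exists_le_ker_of_notMem fun h => hin ⟨hr', h⟩
        exact ⟨χ, h2, Or.inr h1⟩
      · obtain ⟨χ, h1, h2⟩ := Submodule.exists_le_ker_of_notMem hr'
        exact ⟨χ, h2, Or.inl h1⟩
    have hr : χ r = 0 := hχ (Submodule.subset_span (by simp))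
    have hs : χ s = 0 := hχ (Submodule.subset_span (by simp))
    refine Or.inr (Or.inr (Or.inr (Or.inr (Or.inr (Or.inr
      (mem_orb_line11 hMN hpure χ ?_ ?_))))))
    · simp [contractRight_tmul, hr, hs]
    · intro h0
      simp only [map_add, contractRight_tmul] at h0
      have h1 := congrFun h0 0
      have h2 := congrFun h0 1
      simp at h1 h2
      exact hχ'.elim (· h1) (· h2)

/-- The classification of points. -/
lemma mem_orb_of_finrank_one {L : Submodule F (V F)} (hL : Module.finrank F L = 1) :
    L ∈ orb (pt1 F) ∨ L ∈ orb (pt4 F) := by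
  obtain ⟨M, hM0, rfl⟩ := exists_eq_span_singleton hL
  by_cases hpure : ∃ a p, M = a ⊗ₜ[F] p
  · obtain ⟨a, p, rfl⟩ := hpure
    obtain ⟨a', ha⟩ := exists_linearIndependent_left (left_ne_zero hM0)
    obtain ⟨p', hp⟩ := exists_linearIndependent_right (right_ne_zero hM0)
    obtain ⟨k, hk⟩ := exists_linearIndependent_triple hp
    exact Or.inl (span_mem_orb_pt1 ha hk)
  · push Not at hpure
    obtain ⟨r, s, rfl⟩ := eq_add_tmul M
    have hrs : LinearIndependent F ![r, s] := by
      by_contra h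
      by_cases hr : r = 0
      · subst hr
        exact hpure (stdVec F 1) s (by rw [TensorProduct.tmul_zero, zero_add])
      · obtain ⟨c, rfl⟩ := not_linearIndependent_pair hr h
        exact hpure (stdVec F 0 + c • stdVec F 1) r (by
          rw [TensorProduct.tmul_smul, TensorProduct.smul_tmul', ← TensorProduct.add_tmul])
    have he : LinearIndependent F ![stdVec F (0 : Fin 2), stdVec F 1] := by
      rw [LinearIndependent.pair_iff]
      intro x y hxy
      have h0 := congrFun hxy 0
      have h1 := congrFun hxy 1
      simpa using And.intro h0 h1
    obtain ⟨k, hk⟩ := exists_linearIndependent_triple hrs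
    exact Or.inr (span_mem_orb_pt4 he hk)

end

end Tensor23

namespace Tensor23

section

variable {F : Type*} [Field F]

/-! ### Orbits of solids and hyperplanes -/

lemma finrank_span_pair {A B : V F} (h : LinearIndependent F ![A, B]) :
    Module.finrank F (Submodule.span F {A, B}) = 2 := by
  rw [← range_pair, finrank_span_eq_card h, Fintype.card_fin]

lemma linearIndependent_pair_of_coord {A B : V F}
    (h : ∀ x y : F, (∀ i j, x * coord i j A + y * coord i j B = 0) → x = 0 ∧ y = 0) :
    LinearIndependent F ![A, B] := by
  rw [LinearIndependent.pair_iff]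
  intro x y hxy
  refine h x y fun i j => ?_
  simpa using congrArg (coord i j) hxy

lemma finrank_line2 : Module.finrank F (line2 F) = 2 := by
  rw [line2_eq]
  refine finrank_span_pair (linearIndependent_pair_of_coord fun x y h => ?_)
  simpa using And.intro (h 0 0) (h 0 1)

lemma finrank_line4T : Module.finrank F (line4T F) = 2 := by
  rw [line4T_eq]
  refine finrank_span_pair (linearIndependent_pair_of_coord fun x y h => ?_)
  simpa using And.intro (h 0 0) (h 1 0)

lemma finrank_line5 : Module.finrank F (line5 F) = 2 := by
  rw [line5_eq]
  refine finrank_span_pair (linearIndependent_pair_of_coord fun x y h => ?_)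
  simpa using And.intro (h 0 0) (h 1 1)

lemma finrank_line6 : Module.finrank F (line6 F) = 2 := by
  rw [line6_eq]
  refine finrank_span_pair (linearIndependent_pair_of_coord fun x y h => ?_)
  simpa using And.intro (h 0 0) (h 1 0)

lemma finrank_line7 : Module.finrank F (line7 F) = 2 := by
  rw [line7_eq]
  refine finrank_span_pair (linearIndependent_pair_of_coord fun x y h => ?_)
  simpa using And.intro (h 0 0) (h 0 1)

lemma finrank_line10 {u v : F} (hv : v ≠ 0) : Module.finrank F (line10 u v) = 2 := by
  rw [line10_eq]
  refine finrank_span_pair (linearIndependent_pair_of_coord fun x y h => ?_)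
  simpa [hv] using And.intro (h 0 0) (h 1 0)

lemma finrank_line11 : Module.finrank F (line11 F) = 2 := by
  rw [line11_eq]
  refine finrank_span_pair (linearIndependent_pair_of_coord fun x y h => ?_)
  simpa using And.intro (h 0 0) (h 0 1)

lemma finrank_pt1 : Module.finrank F (pt1 F) = 1 := by
  rw [pt1_eq]
  exact finrank_span_singleton fun h => by simpa using congrArg (coord 0 0) h

lemma finrank_pt4 : Module.finrank F (pt4 F) = 1 := by
  rw [pt4_eq]
  exact finrank_span_singleton fun h => by simpa using congrArg (coord 0 0) h

lemma stdPerp_mem_orb {U U' : Submodule F (V F)} (hU : U' ∈ orb U) :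
    stdPerp U' ∈ orb (stdPerp U) :=
  perp_mem_orb (stdForm_nondegenerate 2) (stdForm_isSymm 2) (stdForm_nondegenerate 2)
    (stdForm_isSymm 2) (stdForm_nondegenerate 3) (stdForm_isSymm 3) (stdForm_nondegenerate 3)
    (stdForm_isSymm 3) hU

/-- Taking `⊥` twice returns `U`, so the classification of `stdPerp U` as a line or point classifies
`U`. -/
lemma mem_orb_of_stdPerp_mem_orb {U L R : Submodule F (V F)} (hR : stdPerp L = R)
    (h : stdPerp U ∈ orb L) : U ∈ orb R := by
  rw [← stdPerp_stdPerp U, ← hR]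
  exact stdPerp_mem_orb h

lemma orb_perp_eq {β₁ : LinearMap.BilinForm F (Fin 2 → F)}
    {β₂ : LinearMap.BilinForm F (Fin 3 → F)} (hn₁ : β₁.Nondegenerate) (hs₁ : β₁.IsSymm)
    (hn₂ : β₂.Nondegenerate) (hs₂ : β₂.IsSymm) {L R : Submodule F (V F)} (hL : stdPerp L = R) :
    orb (perp β₁ β₂ L) = orb R := by
  rw [← hL]
  exact orb_eq (perp_mem_orb hn₁ hs₁ (stdForm_nondegenerate 2) (stdForm_isSymm 2) hn₂ hs₂
    (stdForm_nondegenerate 3) (stdForm_isSymm 3) (mem_orb_self L))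

lemma orb_mem_orbitsOfDim {L R : Submodule F (V F)} {k l : ℕ} (hL : Module.finrank F L = k)
    (hR : stdPerp L = R) (hkl : 6 - k = l) : orb R ∈ orbitsOfDim F l :=
  ⟨R, by rw [← hR, finrank_stdPerp, hL, hkl], rfl⟩

lemma orbitsOfDim_four [Finite F] {u v : F} (huv : Admissible u v) :
    orbitsOfDim F 4 = {orb (solid2 F), orb (solid4T F), orb (solid5 F), orb (solid6 F),
      orb (solid7 F), orb (solid10 u v), orb (solid11 F)} := by
  apply Set.Subset.antisymm
  · rintro _ ⟨U, hU, rfl⟩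
    have hL : Module.finrank F (stdPerp U) = 2 := by rw [finrank_stdPerp, hU]
    simp only [Set.mem_insert_iff, Set.mem_singleton_iff]
    rcases isClassified_of_finrank huv hL with h | h | h | h | h | h | h
    · exact Or.inl (orb_eq (mem_orb_of_stdPerp_mem_orb stdPerp_line2 h))
    · exact Or.inr (Or.inl (orb_eq (mem_orb_of_stdPerp_mem_orb stdPerp_line4T h)))
    · exact Or.inr (Or.inr (Or.inl (orb_eq (mem_orb_of_stdPerp_mem_orb stdPerp_line5 h))))
    · exact Or.inr (Or.inr (Or.inr (Or.inl
        (orb_eq (mem_orb_of_stdPerp_mem_orb stdPerp_line6 h)))))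
    · exact Or.inr (Or.inr (Or.inr (Or.inr (Or.inl
        (orb_eq (mem_orb_of_stdPerp_mem_orb stdPerp_line7 h))))))
    · exact Or.inr (Or.inr (Or.inr (Or.inr (Or.inr (Or.inl
        (orb_eq (mem_orb_of_stdPerp_mem_orb (stdPerp_line10 u v) h)))))))
    · exact Or.inr (Or.inr (Or.inr (Or.inr (Or.inr (Or.inr
        (orb_eq (mem_orb_of_stdPerp_mem_orb stdPerp_line11 h)))))))
  · rintro _ (rfl | rfl | rfl | rfl | rfl | rfl | rfl)
    · exact orb_mem_orbitsOfDim finrank_line2 stdPerp_line2 rfl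
    · exact orb_mem_orbitsOfDim finrank_line4T stdPerp_line4T rfl
    · exact orb_mem_orbitsOfDim finrank_line5 stdPerp_line5 rfl
    · exact orb_mem_orbitsOfDim finrank_line6 stdPerp_line6 rfl
    · exact orb_mem_orbitsOfDim finrank_line7 stdPerp_line7 rfl
    · exact orb_mem_orbitsOfDim (finrank_line10 huv.1) (stdPerp_line10 u v) rfl
    · exact orb_mem_orbitsOfDim finrank_line11 stdPerp_line11 rfl

lemma orbitsOfDim_five : orbitsOfDim F 5 = {orb (hyp1 F), orb (hyp4 F)} := by
  apply Set.Subset.antisymm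
  · rintro _ ⟨U, hU, rfl⟩
    have hL : Module.finrank F (stdPerp U) = 1 := by rw [finrank_stdPerp, hU]
    simp only [Set.mem_insert_iff, Set.mem_singleton_iff]
    exact (mem_orb_of_finrank_one hL).imp
      (fun h => orb_eq (mem_orb_of_stdPerp_mem_orb stdPerp_pt1 h))
      (fun h => orb_eq (mem_orb_of_stdPerp_mem_orb stdPerp_pt4 h))
  · rintro _ (rfl | rfl)
    · exact orb_mem_orbitsOfDim finrank_pt1 stdPerp_pt1 rfl
    · exact orb_mem_orbitsOfDim finrank_pt4 stdPerp_pt4 rfl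

lemma orb_ne_of_ncard {U U' : Submodule F (V F)} {m n : ℕ} (hU : (section23 U).ncard = m)
    (hU' : (section23 U').ncard = n) (hmn : m ≠ n) : orb U ≠ orb U' := fun h =>
  hmn (by rw [← hU, ← hU', ncard_section23_of_mem_orb (U' := U) (h ▸ mem_orb_self U)])

lemma orb_ne_of_containsLine21 {U U' : Submodule F (V F)} (hU : ContainsLine21 U)
    (hU' : ¬ ContainsLine21 U') : orb U ≠ orb U' := fun h =>
  hU' (hU.of_mem_orb (h ▸ mem_orb_self U'))

/-- Both solids have `q² + 2q + 1` points of rank one; the Min column tells them apart. -/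
lemma orb_solid2_ne_orb_solid4T : orb (solid2 F) ≠ orb (solid4T F) := fun h => by
  have h' : solid4T F ∈ orb (solid2 F) := by rw [h]; exact mem_orb_self _
  exact absurd ((hasMinSegre_solid2.of_mem_orb h').unique hasMinSegre_solid4T).2 (by decide)

variable [Finite F]

lemma ncard_orbits_solids {u v : F} (huv : Admissible u v) :
    ({orb (solid2 F), orb (solid4T F), orb (solid5 F), orb (solid6 F), orb (solid7 F),
      orb (solid10 u v), orb (solid11 F)} : Set (Set (Submodule F (V F)))).ncard = 7 := by
  have hq : 1 < Nat.card F := Finite.one_lt_card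
  -- This inequality amounts to `q² ≠ q`, hence needs `q > 1`.
  have h35 : Nat.card F ^ 2 + 2 * Nat.card F + 1 ≠ 3 * Nat.card F + 1 := by nlinarith
  have h26 : Nat.card F ^ 2 + 2 * Nat.card F + 1 ≠ 2 * Nat.card F + 1 := by nlinarith
  have h2x : Nat.card F ^ 2 + 2 * Nat.card F + 1 ≠ Nat.card F + 1 := by nlinarith
  have h56 : 3 * Nat.card F + 1 ≠ 2 * Nat.card F + 1 := by lia
  have h5x : 3 * Nat.card F + 1 ≠ Nat.card F + 1 := by lia
  have h6x : 2 * Nat.card F + 1 ≠ Nat.card F + 1 := by lia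
  rw [Set.ncard_insert_of_notMem, Set.ncard_insert_of_notMem, Set.ncard_insert_of_notMem,
    Set.ncard_insert_of_notMem, Set.ncard_insert_of_notMem, Set.ncard_insert_of_notMem,
    Set.ncard_singleton]
  all_goals simp only [Set.mem_insert_iff, Set.mem_singleton_iff, not_or]
  · exact orb_ne_of_containsLine21 (containsLine21_solid10 u v) not_containsLine21_solid11
  · exact ⟨orb_ne_of_ncard ncard_solid7 (ncard_solid10 huv) h6x,
      orb_ne_of_ncard ncard_solid7 ncard_solid11 h6x⟩
  · exact ⟨orb_ne_of_containsLine21 containsLine21_solid6 not_containsLine21_solid7,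
      orb_ne_of_ncard ncard_solid6 (ncard_solid10 huv) h6x,
      orb_ne_of_ncard ncard_solid6 ncard_solid11 h6x⟩
  · exact ⟨orb_ne_of_ncard ncard_solid5 ncard_solid6 h56,
      orb_ne_of_ncard ncard_solid5 ncard_solid7 h56,
      orb_ne_of_ncard ncard_solid5 (ncard_solid10 huv) h5x,
      orb_ne_of_ncard ncard_solid5 ncard_solid11 h5x⟩
  · exact ⟨orb_ne_of_ncard ncard_solid4T ncard_solid5 h35,
      orb_ne_of_ncard ncard_solid4T ncard_solid6 h26,
      orb_ne_of_ncard ncard_solid4T ncard_solid7 h26,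
      orb_ne_of_ncard ncard_solid4T (ncard_solid10 huv) h2x,
      orb_ne_of_ncard ncard_solid4T ncard_solid11 h2x⟩
  · exact ⟨orb_solid2_ne_orb_solid4T,
      orb_ne_of_ncard ncard_solid2 ncard_solid5 h35,
      orb_ne_of_ncard ncard_solid2 ncard_solid6 h26,
      orb_ne_of_ncard ncard_solid2 ncard_solid7 h26,
      orb_ne_of_ncard ncard_solid2 (ncard_solid10 huv) h2x,
      orb_ne_of_ncard ncard_solid2 ncard_solid11 h2x⟩

lemma ncard_orbits_hyperplanes :
    ({orb (hyp1 F), orb (hyp4 F)} : Set (Set (Submodule F (V F)))).ncard = 2 := by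
  have hq : 1 < Nat.card F := Finite.one_lt_card
  exact Set.ncard_pair (orb_ne_of_ncard ncard_hyp1 ncard_hyp4 (by nlinarith))

end

end Tensor23

theorem theorem4p5 (F : Type*) [Field F] [Finite F]
    (β₁ : LinearMap.BilinForm F (Fin 2 → F)) (β₂ : LinearMap.BilinForm F (Fin 3 → F))
    (hn₁ : β₁.Nondegenerate) (hs₁ : β₁.IsSymm) (hn₂ : β₂.Nondegenerate) (hs₂ : β₂.IsSymm)
    (q : ℕ) (hq : q = Nat.card F) :
    (∃ u v : F, Tensor23.Admissible u v) ∧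
    ∀ u v : F, Tensor23.Admissible u v →
      -- the orbits of solids
      (Tensor23.orbitsOfDim F 4).ncard = 7 ∧
      Tensor23.orbitsOfDim F 4 =
        {Tensor23.orb (Tensor23.perp β₁ β₂ (Tensor23.line2 F)),
         Tensor23.orb (Tensor23.perp β₁ β₂ (Tensor23.line4T F)),
         Tensor23.orb (Tensor23.perp β₁ β₂ (Tensor23.line5 F)),
         Tensor23.orb (Tensor23.perp β₁ β₂ (Tensor23.line6 F)),
         Tensor23.orb (Tensor23.perp β₁ β₂ (Tensor23.line7 F)),
         Tensor23.orb (Tensor23.perp β₁ β₂ (Tensor23.line10 u v)),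
         Tensor23.orb (Tensor23.perp β₁ β₂ (Tensor23.line11 F))} ∧
      Tensor23.PerpRow β₁ β₂ (Tensor23.line2 F) (Tensor23.solid2 F)
        Tensor23.IsPlaneAndLine 2 3 (q ^ 2 + 2 * q + 1) ∧
      Tensor23.PerpRow β₁ β₂ (Tensor23.line4T F) (Tensor23.solid4T F)
        (Tensor23.IsSubSegre 2 2) 2 2 (q ^ 2 + 2 * q + 1) ∧
      Tensor23.PerpRow β₁ β₂ (Tensor23.line5 F) (Tensor23.solid5 F)
        Tensor23.IsThreeLines 2 3 (3 * q + 1) ∧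
      Tensor23.PerpRow β₁ β₂ (Tensor23.line6 F) (Tensor23.solid6 F)
        Tensor23.IsTwoLines 2 3 (2 * q + 1) ∧
      Tensor23.PerpRow β₁ β₂ (Tensor23.line7 F) (Tensor23.solid7 F)
        Tensor23.IsConicAndLine 2 3 (2 * q + 1) ∧
      Tensor23.PerpRow β₁ β₂ (Tensor23.line10 u v) (Tensor23.solid10 u v)
        (Tensor23.IsSubSegre 2 1) 2 3 (q + 1) ∧
      Tensor23.PerpRow β₁ β₂ (Tensor23.line11 F) (Tensor23.solid11 F)
        (fun S => (3 ≤ q → Tensor23.IsNormalRationalCurve 3 S) ∧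
          (q = 2 → Tensor23.IsNormalRationalCurve 2 S)) 2 3 (q + 1) ∧
      -- the orbits of hyperplanes
      (Tensor23.orbitsOfDim F 5).ncard = 2 ∧
      Tensor23.orbitsOfDim F 5 =
        {Tensor23.orb (Tensor23.perp β₁ β₂ (Tensor23.pt1 F)),
         Tensor23.orb (Tensor23.perp β₁ β₂ (Tensor23.pt4 F))} ∧
      Tensor23.PerpRow β₁ β₂ (Tensor23.pt1 F) (Tensor23.hyp1 F)
        Tensor23.IsPlaneAndS22 2 3 (2 * q ^ 2 + 2 * q + 1) ∧
      Tensor23.PerpRow β₁ β₂ (Tensor23.pt4 F) (Tensor23.hyp4 F)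
        Tensor23.IsCubicScroll 2 3 ((q + 1) ^ 2) := by

  subst hq
  refine ⟨Tensor23.exists_admissible, fun u v huv => ?_⟩
  -- Each orbit of perps for `β₁`, `β₂` equals the orbit of the explicit representative, so the
  -- statements about sets of orbits no longer involve the forms.
  rw [Tensor23.orb_perp_eq hn₁ hs₁ hn₂ hs₂ Tensor23.stdPerp_line2,
    Tensor23.orb_perp_eq hn₁ hs₁ hn₂ hs₂ Tensor23.stdPerp_line4T,
    Tensor23.orb_perp_eq hn₁ hs₁ hn₂ hs₂ Tensor23.stdPerp_line5,
    Tensor23.orb_perp_eq hn₁ hs₁ hn₂ hs₂ Tensor23.stdPerp_line6,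
    Tensor23.orb_perp_eq hn₁ hs₁ hn₂ hs₂ Tensor23.stdPerp_line7,
    Tensor23.orb_perp_eq hn₁ hs₁ hn₂ hs₂ (Tensor23.stdPerp_line10 u v),
    Tensor23.orb_perp_eq hn₁ hs₁ hn₂ hs₂ Tensor23.stdPerp_line11,
    Tensor23.orb_perp_eq hn₁ hs₁ hn₂ hs₂ Tensor23.stdPerp_pt1,
    Tensor23.orb_perp_eq hn₁ hs₁ hn₂ hs₂ Tensor23.stdPerp_pt4,
    Tensor23.orbitsOfDim_four huv, Tensor23.orbitsOfDim_five]
  refine ⟨Tensor23.ncard_orbits_solids huv, rfl, ?_, ?_, ?_, ?_, ?_, ?_, ?_,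
    Tensor23.ncard_orbits_hyperplanes, rfl, ?_, ?_⟩
  · exact Tensor23.perpRow_of_rep hn₁ hs₁ hn₂ hs₂ (fun _ _ _ h => h.image) Tensor23.stdPerp_line2
      Tensor23.isPlaneAndLine_solid2 Tensor23.hasMinSegre_solid2 Tensor23.ncard_solid2
  · exact Tensor23.perpRow_of_rep hn₁ hs₁ hn₂ hs₂ (fun _ _ _ h => h.image) Tensor23.stdPerp_line4T
      Tensor23.isSubSegre_solid4T Tensor23.hasMinSegre_solid4T Tensor23.ncard_solid4T
  · exact Tensor23.perpRow_of_rep hn₁ hs₁ hn₂ hs₂ (fun _ _ _ h => h.image) Tensor23.stdPerp_line5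
      Tensor23.isThreeLines_solid5 Tensor23.hasMinSegre_solid5 Tensor23.ncard_solid5
  · exact Tensor23.perpRow_of_rep hn₁ hs₁ hn₂ hs₂ (fun _ _ _ h => h.image) Tensor23.stdPerp_line6
      Tensor23.isTwoLines_solid6 Tensor23.hasMinSegre_solid6 Tensor23.ncard_solid6
  · exact Tensor23.perpRow_of_rep hn₁ hs₁ hn₂ hs₂ (fun _ _ _ h => h.image) Tensor23.stdPerp_line7
      Tensor23.isConicAndLine_solid7 Tensor23.hasMinSegre_solid7 Tensor23.ncard_solid7
  · exact Tensor23.perpRow_of_rep hn₁ hs₁ hn₂ hs₂ (fun _ _ _ h => h.image)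
      (Tensor23.stdPerp_line10 u v) (Tensor23.isSubSegre_solid10 huv)
      (Tensor23.hasMinSegre_solid10 huv.1) (Tensor23.ncard_solid10 huv)
  · exact Tensor23.perpRow_of_rep hn₁ hs₁ hn₂ hs₂
      (fun _ _ _ h => ⟨fun h3 => (h.1 h3).image, fun h2 => (h.2 h2).image⟩)
      Tensor23.stdPerp_line11
      ⟨fun _ => Tensor23.isNormalRationalCurve_three_solid11,
        fun h2 => Tensor23.isNormalRationalCurve_two_solid11 h2⟩
      Tensor23.hasMinSegre_solid11 Tensor23.ncard_solid11
  · exact Tensor23.perpRow_of_rep hn₁ hs₁ hn₂ hs₂ (fun _ _ _ h => h.image) Tensor23.stdPerp_pt1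
      Tensor23.isPlaneAndS22_hyp1 Tensor23.hasMinSegre_hyp1 Tensor23.ncard_hyp1
  · exact Tensor23.perpRow_of_rep hn₁ hs₁ hn₂ hs₂ (fun _ _ _ h => h.image) Tensor23.stdPerp_pt4
      Tensor23.isCubicScroll_hyp4 Tensor23.hasMinSegre_hyp4 Tensor23.ncard_hyp4
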